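/- Let $G$ be a finite simple graph with edge set $E(G)$ and maximum degree $\Delta(G)$. The distance of two edges of $G$ is the distance of the corresponding vertices in the line graph of $G$ (infinite if the edges lie in different components). A $2$-tone edge $k$-coloring of $G$ assigns to every edge a set of two colors from $\{1,\dots,k\}$ such that any two distinct edges at distance $d$ share fewer than $d$ colors; $\tau'_2(G)$ denotes the least integer $k\ge 0$ for which $G$ admits a $2$-tone edge $k$-coloring. The graph $G$ is outerplanar if it has an embedding in the plane (vertices are distinct points, edges are simple arcs that meet only in common ends) in which every vertex lies on the boundary of the outer (unbounded) face. If $G$ is outerplanar, then \[ \tau'_2(G)\le \max\{14,\,3\Delta(G)\}. \] -/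

import Mathlib

namespace SimpleGraph

variable {V : Type*}

/-- A `t`-tone edge `k`-coloring: every edge gets a set of `t` colors from `{1, …, k}`, and
two distinct edges at distance `d` share fewer than `d` colors. The distance of two edges is their
distance in the line graph; it is `⊤` for edges in different components. -/
def IsToneEdgeColoring (G : SimpleGraph V) (t k : ℕ) (f : G.edgeSet → Finset ℕ) : Prop :=
  (∀ e, f e ∈ Finset.powersetCard t (Finset.Icc 1 k)) ∧
    ∀ e e', e ≠ e' → (((f e ∩ f e').card : ℕ) : ℕ∞) < G.lineGraph.edist e e'

/-- `G` admits a `t`-tone edge `k`-coloring. -/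
def ToneEdgeColorable (G : SimpleGraph V) (t k : ℕ) : Prop :=
  ∃ f : G.edgeSet → Finset ℕ, G.IsToneEdgeColoring t k f

/-- The `t`-tone chromatic index: the least `k` such that `G` admits a `t`-tone edge
`k`-coloring (`⊤` if there is no such `k`). -/
noncomputable def toneChromaticIndex (G : SimpleGraph V) (t : ℕ) : ℕ∞ :=
  ⨅ k ∈ {k : ℕ | G.ToneEdgeColorable t k}, (k : ℕ∞)

/-- An embedding of `G` in the Euclidean plane (identified with `ℂ`): vertices are distinct
points, every edge is a simple arc joining its two ends, and an interior point of an arc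
is neither a vertex nor a point of another arc. -/
structure PlaneEmbedding (G : SimpleGraph V) where
  /-- the point representing a vertex -/
  point : V → ℂ
  point_injective : Function.Injective point
  /-- the arc representing an edge, with a parametrization -/
  arc : G.edgeSet → C(unitInterval, ℂ)
  arc_injective : ∀ e, Function.Injective (arc e)
  arc_ends : ∀ e : G.edgeSet, s(arc e 0, arc e 1) = Sym2.map point (e : Sym2 V)
  arc_interior_vertex : ∀ e s v, arc e s = point v → s = 0 ∨ s = 1
  arc_interior_arc : ∀ e e' s s', e ≠ e' → arc e s = arc e' s' → s = 0 ∨ s = 1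

namespace PlaneEmbedding

variable {G : SimpleGraph V}

/-- The set of all points of the plane covered by the vertices and the edges. -/
def drawing (φ : G.PlaneEmbedding) : Set ℂ :=
  Set.range φ.point ∪ ⋃ e, Set.range (φ.arc e)

/-- The outer face: the unbounded component of the complement of the drawing. -/
def outerFace (φ : G.PlaneEmbedding) : Set ℂ :=
  {z | z ∉ φ.drawing ∧ ¬ Bornology.IsBounded (connectedComponentIn φ.drawingᶜ z)}

end PlaneEmbedding

/-- `G` is outerplanar if it has an embedding in the plane such that every vertex lies on the
boundary of the outer face. -/
def IsOuterplanar (G : SimpleGraph V) : Prop :=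
  ∃ φ : G.PlaneEmbedding, ∀ v, φ.point v ∈ frontier φ.outerFace

end SimpleGraph

/-! Edges with a common end need disjoint pairs of colors, edges joined by an edge need different
pairs, and edges farther apart are unconstrained. An edge `uv` that is colored last thus loses at
most two colors to each adjacent edge and one pair to each edge at distance two
(`IsPartialColoring.exists_insert`). With at least max{14, 3Δ} colors, enough pairs remain in four
configurations: a leaf whose neighbor has at most four neighbors that are not leaves, a path of
three vertices of degree two, a 4-cycle with two adjacent vertices of degree two, and a triangle
with one vertex of degree two and another of degree at most four. The coloring follows by induction
on subgraphs (`exists_coloring`) once one of these is known to occur.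

Outerplanarity enters only by excluding K₄ and K₂,₃ minors: a new vertex in the outer face would
turn them into drawings of K₅ and K₃,₃, which a parity argument with turning numbers rules out.

To find a configuration, delete all leaves and take a minimal pocket `A`, a connected set of at
least two vertices attached at one vertex or at an edge `ab`. In the case of an edge, a shortest
cycle through `ab` and `A` is chordless. The excluded minors and minimality make every vertex of `A`
off the cycle an ear: its neighbors are the two ends of a cycle edge, and each edge carries at most
one ear. An ear yields the triangle; without ears the cycle yields the 4-cycle or the path.
Attachment at one vertex again yields the triangle. -/

section

open unitInterval

/-! ### Continuous logarithms along plane paths -/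

namespace ContinuousMap

/-- The change of a continuous logarithm of `g` along the unit interval. -/
noncomputable def logChange (g : C(I, ℂ)) : ℂ :=
  open Classical in
  if h : ∃ L : C(I, ℂ), ∀ t, Complex.exp (L t) = g t then h.choose 1 - h.choose 0 else 0

lemma exists_log {E : Type*} [NormedAddCommGroup E] [NormedSpace ℝ E] (g : C(E, ℂ))
    (hg : ∀ t, g t ≠ 0) : ∃ L : C(E, ℂ), ∀ t, Complex.exp (L t) = g t := by
  obtain ⟨L, ⟨-, hL⟩, -⟩ := Complex.isCoveringMapOn_exp.existsUnique_continuousMap_lifts g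
    (a₀ := 0) (e₀ := Complex.log (g 0)) (Complex.exp_log (hg 0)) (fun t => by simpa using hg t)
  exact ⟨L, fun t => congrFun hL t⟩

lemma exists_log_unitInterval (g : C(I, ℂ)) (hg : ∀ t, g t ≠ 0) :
    ∃ L : C(I, ℂ), ∀ t, Complex.exp (L t) = g t := by
  obtain ⟨L, hL⟩ := exists_log
    (⟨fun x => g (Set.projIcc 0 1 zero_le_one x), by fun_prop⟩ : C(ℝ, ℂ)) fun x => hg _
  exact ⟨⟨fun t => L t, by fun_prop⟩, fun t => by simp [hL]⟩

lemma exists_log_unitSquare (g : C(I × I, ℂ)) (hg : ∀ t, g t ≠ 0) :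
    ∃ L : C(I × I, ℂ), ∀ t, Complex.exp (L t) = g t := by
  obtain ⟨L, hL⟩ := exists_log (⟨fun x => g (Set.projIcc 0 1 zero_le_one x.1,
    Set.projIcc 0 1 zero_le_one x.2), by fun_prop⟩ : C(ℝ × ℝ, ℂ)) fun x => hg _
  exact ⟨⟨fun t => L (t.1, t.2), by fun_prop⟩, fun t => by simp [hL]⟩

/-- Two continuous logarithms of the same function differ by a constant, so the choice made in
`logChange` does not matter. -/
lemma log_sub_eq_log_sub {L M : C(I, ℂ)} (h : ∀ t, Complex.exp (L t) = Complex.exp (M t)) :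
    L 1 - L 0 = M 1 - M 0 := by
  have key : (fun t => L t) = fun t => M t + (L 0 - M 0) := by
    refine Complex.isCoveringMap_exp.eq_of_comp_eq (by fun_prop) (by fun_prop) ?_ 0 (by ring)
    funext t
    apply Subtype.ext
    change Complex.exp (L t) = Complex.exp (M t + (L 0 - M 0))
    rw [Complex.exp_add, Complex.exp_sub, h 0, div_self (Complex.exp_ne_zero _), mul_one, h t]
  rw [show L 1 = _ from congrFun key 1]; ring

lemma logChange_eq {g L : C(I, ℂ)} (h : ∀ t, Complex.exp (L t) = g t) :
    g.logChange = L 1 - L 0 := by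
  have hex : ∃ L : C(I, ℂ), ∀ t, Complex.exp (L t) = g t := ⟨L, h⟩
  rw [logChange, dif_pos hex]
  exact log_sub_eq_log_sub fun t => (hex.choose_spec t).trans (h t).symm

lemma exp_logChange {g : C(I, ℂ)} (hg : ∀ t, g t ≠ 0) :
    Complex.exp g.logChange = g 1 / g 0 := by
  obtain ⟨L, hL⟩ := g.exists_log_unitInterval hg
  rw [logChange_eq hL, Complex.exp_sub, hL, hL]

/-- A logarithm of the difference of two disjoint paths on the unit square has
total change zero along its boundary. -/
lemma logChange_square {γ γ' : C(I, ℂ)} (h : ∀ s t, γ s ≠ γ' t) :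
    logChange (γ - const I (γ' 0)) - logChange (γ - const I (γ' 1))
      + logChange (γ' - const I (γ 1)) - logChange (γ' - const I (γ 0)) = 0 := by
  -- `M` is a single-valued logarithm of `γ s - γ' t`; the four terms are its increments along the
  -- sides of the square.
  obtain ⟨M, hM⟩ := exists_log_unitSquare
    (⟨fun p : I × I => γ p.1 - γ' p.2, by fun_prop⟩ : C(I × I, ℂ)) fun p => sub_ne_zero.2 (h _ _)
  simp only [coe_mk] at hM
  have h1 (t : I) : logChange (γ - const I (γ' t)) = M (1, t) - M (0, t) :=
    logChange_eq (L := ⟨fun s => M (s, t), by fun_prop⟩) fun s => by simp [hM]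
  -- Here the function is the negative of the one with logarithm `M`; the shift by `π i` cancels in
  -- the increment.
  have h2 (s : I) : logChange (γ' - const I (γ s)) = M (s, 1) - M (s, 0) := by
    rw [logChange_eq (L := ⟨fun t => M (s, t) + Real.pi * Complex.I, by fun_prop⟩) fun t => by
      simp [Complex.exp_add, hM]]
    simp
  rw [h1, h1, h2, h2]; ring

end ContinuousMap

/-! ### Nonplanarity of K₅ and K₃,₃ -/

open ContinuousMap

/-- A logarithm of `P i - P j`, chosen such that exchanging `i` and `j` adds or subtracts `π i`. -/
noncomputable def logDiff (P : ℕ → ℂ) (i j : ℕ) : ℂ :=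
  if i < j then Complex.log (P i - P j) else Complex.log (P j - P i) + Real.pi * Complex.I

lemma exp_logDiff {P : ℕ → ℂ} {i j : ℕ} (h : P i ≠ P j) :
    Complex.exp (logDiff P i j) = P i - P j := by
  unfold logDiff
  split_ifs
  · rw [Complex.exp_log (sub_ne_zero.2 h)]
  · rw [Complex.exp_add, Complex.exp_log (sub_ne_zero.2 h.symm), Complex.exp_pi_mul_I]; ring

lemma logDiff_sub_swap (P : ℕ → ℂ) {i j : ℕ} (h : i ≠ j) :
    logDiff P i j - logDiff P j i = (if i < j then (-1 : ℤ) else 1) * (Real.pi * Complex.I) := by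
  unfold logDiff
  rcases lt_or_gt_of_ne h with h | h
  · simp [h, h.not_gt]
  · simp [h, h.not_gt]

/-- Given paths between finitely many points, there are integers `n a b c` (turning numbers of the
path from `a` to `b` about `c`) that satisfy a linear relation for every pair of disjoint paths. -/
theorem exists_turning_numbers (P : ℕ → ℂ) (γ : ℕ → ℕ → C(I, ℂ)) :
    ∃ n : ℕ → ℕ → ℕ → ℤ, ∀ a b c d, γ a b 0 = P a → γ a b 1 = P b → γ c d 0 = P c →
      γ c d 1 = P d → (∀ s t, γ a b s ≠ γ c d t) →
      2 * (n a b c - n a b d + n c d b - n c d a) + (if b < c then -1 else 1)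
        - (if a < c then -1 else 1) - (if b < d then -1 else 1)
        + (if a < d then -1 else 1) = 0 := by
  -- Both sides are logarithms of `(P b - P c) / (P a - P c)`, hence differ by a multiple of `2 π
  -- i`.
  have key (a b c : ℕ) : ∃ n : ℤ, γ a b 0 = P a → γ a b 1 = P b → (∀ t, γ a b t ≠ P c) →
      logChange (γ a b - const I (P c)) =
        logDiff P b c - logDiff P a c + n * (2 * Real.pi * Complex.I) := by
    by_cases h : γ a b 0 = P a ∧ γ a b 1 = P b ∧ ∀ t, γ a b t ≠ P c
    · obtain ⟨h0, h1, h⟩ := h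
      have : Complex.exp (logChange (γ a b - const I (P c))) =
          Complex.exp (logDiff P b c - logDiff P a c) := by
        rw [exp_logChange fun t => by simpa [sub_eq_zero] using h t, Complex.exp_sub,
          exp_logDiff (h1 ▸ h 1), exp_logDiff (h0 ▸ h 0)]
        simp [h0, h1]
      obtain ⟨n, hn⟩ := Complex.exp_eq_exp_iff_exists_int.1 this
      exact ⟨n, fun _ _ _ => hn⟩
    · exact ⟨0, fun h0 h1 h2 => absurd ⟨h0, h1, h2⟩ h⟩
  choose n hn using key
  refine ⟨n, fun a b c d ha hb hc hd h => ?_⟩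
  have sq := logChange_square h
  rw [ha, hb, hc, hd, hn a b c ha hb fun t => hc ▸ h t 0, hn a b d ha hb fun t => hd ▸ h t 1,
    hn c d b hc hd fun t => hb ▸ (h 1 t).symm, hn c d a hc hd fun t => ha ▸ (h 0 t).symm] at sq
  have ne {x y : ℕ} (h : P x ≠ P y) : x ≠ y := fun e => h (e ▸ rfl)
  have e1 := logDiff_sub_swap P (ne (hb ▸ hc ▸ h 1 0 : P b ≠ P c))
  have e2 := logDiff_sub_swap P (ne (ha ▸ hc ▸ h 0 0 : P a ≠ P c))
  have e3 := logDiff_sub_swap P (ne (hb ▸ hd ▸ h 1 1 : P b ≠ P d))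
  have e4 := logDiff_sub_swap P (ne (ha ▸ hd ▸ h 0 1 : P a ≠ P d))
  have hpi : (Real.pi * Complex.I : ℂ) ≠ 0 := by simp [Real.pi_ne_zero]
  generalize (if b < c then (-1 : ℤ) else 1) = s1 at *
  generalize (if a < c then (-1 : ℤ) else 1) = s2 at *
  generalize (if b < d then (-1 : ℤ) else 1) = s3 at *
  generalize (if a < d then (-1 : ℤ) else 1) = s4 at *
  -- The logarithms of the differences cancel in pairs `i j`, `j i`, up to `± π i`.
  have : ((2 * (n a b c - n a b d + n c d b - n c d a) + s1 - s2 - s3 + s4 : ℤ) : ℂ)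
      * (Real.pi * Complex.I) = 0 := by
    push_cast
    linear_combination sq - e1 + e2 + e3 - e4
  exact_mod_cast (mul_eq_zero.1 this).resolve_right hpi

/-- The complete graph on five vertices has no drawing in the plane in which independent edges
are disjoint. -/
theorem not_drawing_completeGraph_five (P : ℕ → ℂ) (E : ℕ → ℕ → Set ℂ)
    (hE : ∀ a b, a < b → b < 5 → JoinedIn (E a b) (P a) (P b))
    (hd : ∀ a b c d, a < b → b < 5 → c < d → d < 5 → a ≠ c → a ≠ d → b ≠ c → b ≠ d →
      Disjoint (E a b) (E c d)) : False := by
  have (a b : ℕ) : ∃ γ : C(I, ℂ), a < b → b < 5 →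
      γ 0 = P a ∧ γ 1 = P b ∧ ∀ t, γ t ∈ E a b := by
    by_cases h : a < b ∧ b < 5
    · obtain ⟨γ, hγ⟩ := hE a b h.1 h.2
      exact ⟨γ.toContinuousMap, fun _ _ => ⟨γ.source, γ.target, hγ⟩⟩
    · exact ⟨const I 0, fun h1 h2 => absurd ⟨h1, h2⟩ h⟩
  choose γ hγ using this
  obtain ⟨n, hn⟩ := exists_turning_numbers P γ
  have key (a b c d : ℕ) (h1 : a < b) (h2 : b < 5) (h3 : c < d) (h4 : d < 5) (h5 : a ≠ c)
      (h6 : a ≠ d) (h7 : b ≠ c) (h8 : b ≠ d) :=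
    hn a b c d (hγ a b h1 h2).1 (hγ a b h1 h2).2.1 (hγ c d h3 h4).1 (hγ c d h3 h4).2.1
      fun s t => (hd a b c d h1 h2 h3 h4 h5 h6 h7 h8).ne_of_mem
        ((hγ a b h1 h2).2.2 s) ((hγ c d h3 h4).2.2 t)
  -- Halve the 15 relations and add them modulo 2. Each turning number occurs twice and cancels. The
  -- halved sign sum is odd exactly when the ends of the two edges interlace, which happens for five
  -- pairs of edges, an odd number.
  have e1 := key 0 1 2 3
  have e2 := key 0 1 2 4
  have e3 := key 0 1 3 4
  have e4 := key 0 2 1 3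
  have e5 := key 0 2 1 4
  have e6 := key 0 2 3 4
  have e7 := key 0 3 1 2
  have e8 := key 0 3 1 4
  have e9 := key 0 3 2 4
  have e10 := key 0 4 1 2
  have e11 := key 0 4 1 3
  have e12 := key 0 4 2 3
  have e13 := key 1 2 3 4
  have e14 := key 1 3 2 4
  have e15 := key 1 4 2 3
  norm_num at e1 e2 e3 e4 e5 e6 e7 e8 e9 e10 e11 e12 e13 e14 e15
  omega

/-- The complete bipartite graph on three and three vertices has no drawing in the plane in which
independent edges are disjoint. -/
theorem not_drawing_completeBipartiteGraph_three_three (P : ℕ → ℂ) (E : ℕ → ℕ → Set ℂ)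
    (hE : ∀ a b, a < 3 → 3 ≤ b → b < 6 → JoinedIn (E a b) (P a) (P b))
    (hd : ∀ a b c d, a < 3 → 3 ≤ b → b < 6 → c < 3 → 3 ≤ d → d < 6 → a ≠ c → b ≠ d →
      Disjoint (E a b) (E c d)) : False := by
  have (a b : ℕ) : ∃ γ : C(I, ℂ), a < 3 → 3 ≤ b → b < 6 →
      γ 0 = P a ∧ γ 1 = P b ∧ ∀ t, γ t ∈ E a b := by
    by_cases h : a < 3 ∧ 3 ≤ b ∧ b < 6
    · obtain ⟨γ, hγ⟩ := hE a b h.1 h.2.1 h.2.2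
      exact ⟨γ.toContinuousMap, fun _ _ _ => ⟨γ.source, γ.target, hγ⟩⟩
    · exact ⟨const I 0, fun h1 h2 h3 => absurd ⟨h1, h2, h3⟩ h⟩
  choose γ hγ using this
  obtain ⟨n, hn⟩ := exists_turning_numbers P γ
  have key (a c b d : ℕ) (h1 : a < 3) (h2 : 3 ≤ b) (h2' : b < 6) (h3 : c < 3) (h4 : 3 ≤ d)
      (h4' : d < 6) (h5 : a ≠ c) (h6 : b ≠ d) :=
    hn a b c d (hγ a b h1 h2 h2').1 (hγ a b h1 h2 h2').2.1 (hγ c d h3 h4 h4').1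
      (hγ c d h3 h4 h4').2.1
      fun s t => (hd a b c d h1 h2 h2' h3 h4 h4' h5 h6).ne_of_mem
        ((hγ a b h1 h2 h2').2.2 s) ((hγ c d h3 h4 h4').2.2 t)
  -- The same parity count: each turning number occurs twice among the 18 relations, and nine pairs
  -- of edges interlace.
  have e1 := key 0 1 3 4
  have e2 := key 0 1 3 5
  have e3 := key 0 1 4 3
  have e4 := key 0 1 4 5
  have e5 := key 0 1 5 3
  have e6 := key 0 1 5 4
  have e7 := key 0 2 3 4
  have e8 := key 0 2 3 5
  have e9 := key 0 2 4 3
  have e10 := key 0 2 4 5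
  have e11 := key 0 2 5 3
  have e12 := key 0 2 5 4
  have e13 := key 1 2 3 4
  have e14 := key 1 2 3 5
  have e15 := key 1 2 4 3
  have e16 := key 1 2 4 5
  have e17 := key 1 2 5 3
  have e18 := key 1 2 5 4
  norm_num at e1 e2 e3 e4 e5 e6 e7 e8 e9 e10 e11 e12 e13 e14 e15 e16 e17 e18
  omega

end

/-! ### Outerplanar graphs have no K₄ minor and no K₂,₃ minor -/

section

open unitInterval

lemma isPathConnected_norm_gt {R : ℝ} (hR : 0 < R) : IsPathConnected {z : ℂ | R < ‖z‖} := by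
  have h : Complex.exp '' {z | Real.log R < z.re} = {z : ℂ | R < ‖z‖} := by
    ext w
    constructor
    · rintro ⟨z, hz, rfl⟩
      simpa [Complex.norm_exp, ← Real.log_lt_iff_lt_exp hR] using hz
    · intro hw
      have hw0 : 0 < ‖w‖ := hR.trans hw
      refine ⟨Complex.log w, ?_, Complex.exp_log (norm_pos_iff.1 hw0)⟩
      simpa [Complex.log_re] using Real.log_lt_log hR hw
  rw [← h]
  exact ((convex_halfSpace_re_gt (Real.log R)).isPathConnected
    ⟨((Real.log R + 1 : ℝ) : ℂ), lt_add_one (Real.log R)⟩).image Complex.continuous_exp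

namespace SimpleGraph

variable {V : Type*} {G : SimpleGraph V}

/-- `G` has a minor isomorphic to the complete graph on four vertices. The `T i` are the branch
sets. -/
def HasK4Minor (G : SimpleGraph V) : Prop :=
  ∃ T : ℕ → Set V, (∀ i < 4, (G.induce (T i)).Connected) ∧
    (∀ i < 4, ∀ j < i, Disjoint (T i) (T j)) ∧
    ∀ i < 4, ∀ j < i, ∃ x ∈ T i, ∃ y ∈ T j, G.Adj x y

/-- `G` has a minor isomorphic to the complete bipartite graph on two and three vertices.
The `T i` with `1 ≤ i ≤ 2` and with `3 ≤ i ≤ 5` are the branch sets of the two sides. -/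
def HasK23Minor (G : SimpleGraph V) : Prop :=
  ∃ T : ℕ → Set V, (∀ i < 6, 1 ≤ i → (G.induce (T i)).Connected) ∧
    (∀ i < 6, ∀ j < i, 1 ≤ j → Disjoint (T i) (T j)) ∧
    ∀ i < 6, 3 ≤ i → ∀ j < 3, 1 ≤ j → ∃ x ∈ T i, ∃ y ∈ T j, G.Adj x y

lemma connected_induce_mono {H : SimpleGraph V} (h : H ≤ G) {S : Set V}
    (hS : (H.induce S).Connected) : (G.induce S).Connected :=
  hS.mono fun _ _ hab => h hab

lemma HasK4Minor.mono {H : SimpleGraph V} (h : H ≤ G) : H.HasK4Minor → G.HasK4Minor :=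
  fun ⟨T, hc, hd, ha⟩ => ⟨T, fun i hi => connected_induce_mono h (hc i hi), hd, fun i hi j hj =>
    let ⟨x, hx, y, hy, hxy⟩ := ha i hi j hj
    ⟨x, hx, y, hy, h hxy⟩⟩

lemma HasK23Minor.mono {H : SimpleGraph V} (h : H ≤ G) : H.HasK23Minor → G.HasK23Minor :=
  fun ⟨T, hc, hd, ha⟩ => ⟨T, fun i hi h1 => connected_induce_mono h (hc i hi h1), hd,
    fun i hi h1 j hj h2 =>
      let ⟨x, hx, y, hy, hxy⟩ := ha i hi h1 j hj h2
      ⟨x, hx, y, hy, h hxy⟩⟩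

namespace PlaneEmbedding

/-- The part of the drawing that belongs to the subgraph induced by `S`. -/
def drawingOn (φ : G.PlaneEmbedding) (S : Set V) : Set ℂ :=
  φ.point '' S ∪ ⋃ e ∈ {e : G.edgeSet | ∀ v ∈ (e : Sym2 V), v ∈ S}, Set.range (φ.arc e)

variable (φ : G.PlaneEmbedding)

lemma drawingOn_subset_drawing (S : Set V) : φ.drawingOn S ⊆ φ.drawing :=
  Set.union_subset_union (Set.image_subset_range _ _)
    (Set.iUnion_mono fun _ => Set.iUnion_subset fun _ => subset_rfl)

lemma drawingOn_univ : φ.drawingOn Set.univ = φ.drawing := by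
  simp [drawingOn, drawing]

lemma drawingOn_mono {S T : Set V} (h : S ⊆ T) : φ.drawingOn S ⊆ φ.drawingOn T :=
  Set.union_subset_union (Set.image_mono h)
    (Set.biUnion_subset_biUnion_left fun _ he v hv => h (he v hv))

lemma isCompact_drawingOn [Finite V] (S : Set V) : IsCompact (φ.drawingOn S) :=
  ((Set.toFinite S).image _).isCompact.union <|
    (Set.toFinite _).isCompact_biUnion fun e _ => isCompact_range (φ.arc e).continuous

lemma exists_point_eq_of_end {e : G.edgeSet} {s : I} (hs : s = 0 ∨ s = 1) :
    ∃ v ∈ (e : Sym2 V), φ.arc e s = φ.point v := by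
  have h : φ.arc e s ∈ Sym2.map φ.point (e : Sym2 V) := by
    rw [← φ.arc_ends e]
    rcases hs with rfl | rfl <;> simp
  obtain ⟨v, hv, h⟩ := Sym2.mem_map.1 h
  exact ⟨v, hv, h.symm⟩

lemma point_mem_drawingOn {S : Set V} {v : V} : φ.point v ∈ φ.drawingOn S ↔ v ∈ S := by
  refine ⟨?_, fun h => Or.inl ⟨v, h, rfl⟩⟩
  rintro (⟨u, hu, h⟩ | h)
  · exact φ.point_injective h ▸ hu
  · simp only [Set.mem_ofPred_eq, Set.mem_iUnion, Set.mem_range] at h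
    obtain ⟨e, he, s, hs⟩ := h
    obtain ⟨u, hu, h⟩ := φ.exists_point_eq_of_end (φ.arc_interior_vertex e s v hs)
    exact φ.point_injective (h.symm.trans hs) ▸ he u hu

lemma disjoint_drawingOn {S T : Set V} (h : Disjoint S T) :
    Disjoint (φ.drawingOn S) (φ.drawingOn T) := by
  rw [Set.disjoint_left]
  rintro z (⟨v, hv, rfl⟩ | hz) hzT
  · exact Set.disjoint_left.1 h hv (φ.point_mem_drawingOn.1 hzT)
  simp only [Set.mem_ofPred_eq, Set.mem_iUnion, Set.mem_range] at hz
  obtain ⟨e, he, s, rfl⟩ := hz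
  have hend (hs : s = 0 ∨ s = 1) : False := by
    obtain ⟨v, hv, hsv⟩ := φ.exists_point_eq_of_end hs (e := e)
    rw [hsv, φ.point_mem_drawingOn] at hzT
    exact Set.disjoint_left.1 h (he v hv) hzT
  rcases hzT with ⟨v, -, hv⟩ | hz
  · exact hend (φ.arc_interior_vertex e s v hv.symm)
  · simp only [Set.mem_ofPred_eq, Set.mem_iUnion, Set.mem_range] at hz
    obtain ⟨e', he', s', hs'⟩ := hz
    have hne : e ≠ e' := by
      rintro rfl
      obtain ⟨v, hv, -⟩ := φ.exists_point_eq_of_end (e := e) (s := 0) (Or.inl rfl)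
      exact Set.disjoint_left.1 h (he v hv) (he' v hv)
    exact hend (φ.arc_interior_arc e e' s s' hne hs'.symm)

lemma joinedIn_drawingOn_of_adj {S : Set V} {x y : V} (hx : x ∈ S) (hy : y ∈ S)
    (h : G.Adj x y) : JoinedIn (φ.drawingOn S) (φ.point x) (φ.point y) := by
  let e : G.edgeSet := ⟨s(x, y), h⟩
  have hsub : Set.range (φ.arc e) ⊆ φ.drawingOn S := by
    refine (Set.subset_biUnion_of_mem (u := fun e => Set.range (φ.arc e)) ?_).trans
      Set.subset_union_right
    simp [e, hx, hy]
  have : PathConnectedSpace I := isPathConnected_iff_pathConnectedSpace.1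
    ((convex_Icc (0 : ℝ) 1).isPathConnected ⟨0, by simp⟩)
  have hr := isPathConnected_range (φ.arc e).continuous
  have he : s(φ.arc e 0, φ.arc e 1) = s(φ.point x, φ.point y) := φ.arc_ends e
  have hxy : φ.point x ∈ Set.range (φ.arc e) ∧ φ.point y ∈ Set.range (φ.arc e) := by
    rcases Sym2.eq_iff.1 he with ⟨h0, h1⟩ | ⟨h0, h1⟩
    · exact ⟨⟨0, h0⟩, ⟨1, h1⟩⟩
    · exact ⟨⟨1, h1⟩, ⟨0, h0⟩⟩
  exact (hr.joinedIn _ hxy.1 _ hxy.2).mono hsub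

lemma joinedIn_drawingOn {S : Set V} (hS : (G.induce S).Connected) {x y : V} (hx : x ∈ S)
    (hy : y ∈ S) : JoinedIn (φ.drawingOn S) (φ.point x) (φ.point y) := by
  have key : ∀ a b : S, (G.induce S).Walk a b →
      JoinedIn (φ.drawingOn S) (φ.point a) (φ.point b) := by
    intro a b p
    induction p with
    | nil => exact JoinedIn.refl (φ.point_mem_drawingOn.2 (Subtype.coe_prop _))
    | cons h _ ih => exact (φ.joinedIn_drawingOn_of_adj (Subtype.coe_prop _)
        (Subtype.coe_prop _) h).trans ih
  obtain ⟨p⟩ := hS.preconnected ⟨x, hx⟩ ⟨y, hy⟩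
  exact key _ _ p

lemma isCompact_drawing [Finite V] : IsCompact φ.drawing :=
  φ.drawingOn_univ ▸ φ.isCompact_drawingOn Set.univ

/-- The outer face is path connected. -/
lemma joinedIn_compl_drawing [Finite V] {w z : ℂ} (hw : w ∈ φ.outerFace)
    (hz : z ∈ φ.outerFace) : JoinedIn φ.drawingᶜ w z := by
  obtain ⟨R, hR, hsub⟩ := φ.isCompact_drawing.isBounded.subset_closedBall_lt 0 0
  -- By definition the outer face is a union of unbounded components; each of them reaches beyond
  -- the ball that contains the drawing, where all points can be joined.
  have far : ∀ u ∈ φ.outerFace, ∃ u', R < ‖u'‖ ∧ JoinedIn φ.drawingᶜ u u' := by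
    intro u hu
    have hopen : IsOpen φ.drawingᶜ := φ.isCompact_drawing.isClosed.isOpen_compl
    obtain ⟨u', hu', hR'⟩ : ∃ u' ∈ connectedComponentIn φ.drawingᶜ u, R < ‖u'‖ := by
      by_contra! hcon
      exact hu.2 ((Metric.isBounded_closedBall (x := (0 : ℂ)) (r := R)).subset
        fun x hx => by simpa using hcon x hx)
    refine ⟨u', hR', ?_⟩
    have hc : IsConnected (connectedComponentIn φ.drawingᶜ u) :=
      isConnected_connectedComponentIn_iff.2 hu.1
    have hp := hopen.connectedComponentIn.isConnected_iff_isPathConnected.1 hc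
    exact (hp.joinedIn _ (mem_connectedComponentIn hu.1) _ hu').mono
      (connectedComponentIn_subset _ _)
  obtain ⟨w', hw', hww'⟩ := far w hw
  obtain ⟨z', hz', hzz'⟩ := far z hz
  refine (hww'.trans ?_).trans hzz'.symm
  refine ((isPathConnected_norm_gt hR).joinedIn _ hw' _ hz').mono fun x hx hx' => ?_
  have := hsub hx'
  simp only [Set.mem_ofPred_eq, Metric.mem_closedBall, dist_zero_right] at hx this
  linarith

/-- A vertex on the boundary of the outer face can be joined to any point of the outer face
without meeting the rest of the drawing. -/
lemma joinedIn_of_mem_frontier [Finite V] {w : ℂ} (hw : w ∈ φ.outerFace) {v : V}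
    (hv : φ.point v ∈ frontier φ.outerFace) :
    JoinedIn (φ.drawingOn {v}ᶜ)ᶜ w (φ.point v) := by
  have hopen : IsOpen (φ.drawingOn {v}ᶜ)ᶜ := (φ.isCompact_drawingOn _).isClosed.isOpen_compl
  have hmem : φ.point v ∈ (φ.drawingOn {v}ᶜ)ᶜ := by
    simp [φ.point_mem_drawingOn]
  -- A small ball about the vertex misses the other vertices and all arcs not ending here, but
  -- contains a point of the outer face.
  obtain ⟨ε, hε, hball⟩ := Metric.isOpen_iff.1 hopen _ hmem
  obtain ⟨z, hz, hzd⟩ := Metric.mem_closure_iff.1 (frontier_subset_closure hv) ε hε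
  refine ((φ.joinedIn_compl_drawing hw hz).mono
    (Set.compl_subset_compl.2 (φ.drawingOn_subset_drawing _))).trans ?_
  refine (((convex_ball (φ.point v) ε).isPathConnected ⟨_, Metric.mem_ball_self hε⟩).joinedIn _
    ?_ _ (Metric.mem_ball_self hε)).mono hball
  rwa [Metric.mem_ball, _root_.dist_comm]

end PlaneEmbedding

lemma exists_mem_of_connected_induce {S : Set V} (h : (G.induce S).Connected) : ∃ x, x ∈ S :=
  let ⟨x⟩ := h.nonempty
  ⟨x, x.2⟩

/-- A point `w` of the outer face serves as fifth vertex of a K₅. Its edge to `s i` avoids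
everything drawn without `s i`, in particular the other branch sets. -/
theorem IsOuterplanar.not_hasK4Minor [Finite V] (hG : G.IsOuterplanar) : ¬ G.HasK4Minor := by
  rintro ⟨T, hc, hd, ha⟩
  obtain ⟨φ, hφ⟩ := hG
  have hex (i : ℕ) : ∃ x, i < 4 → x ∈ T i := by
    by_cases hi : i < 4
    · exact (exists_mem_of_connected_induce (hc i hi)).imp fun x hx _ => hx
    · exact ⟨(exists_mem_of_connected_induce (hc 0 (by norm_num))).choose, fun h => absurd h hi⟩
  choose s hs using hex
  obtain ⟨w, hw⟩ : φ.outerFace.Nonempty :=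
    closure_nonempty_iff.1 ⟨_, frontier_subset_closure (hφ (s 0))⟩
  have hd' {i j : ℕ} (hi : i < 4) (hj : j < 4) (hij : i ≠ j) : Disjoint (T i) (T j) := by
    rcases lt_or_gt_of_ne hij with h | h
    · exact (hd j hj i h).symm
    · exact hd i hi j h
  have hnot {i j k : ℕ} (hi : i < 4) (hj : j < 4) (hk : k < 4) (hij : i ≠ j) (hik : i ≠ k) :
      T j ∪ T k ⊆ {s i}ᶜ := by
    rintro x hx rfl
    rcases hx with hx | hx
    · exact Set.disjoint_left.1 (hd' hi hj hij) (hs i hi) hx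
    · exact Set.disjoint_left.1 (hd' hi hk hik) (hs i hi) hx
  refine not_drawing_completeGraph_five (fun i => if i < 4 then φ.point (s i) else w)
    (fun a b => if b < 4 then φ.drawingOn (T a ∪ T b) else (φ.drawingOn {s a}ᶜ)ᶜ) ?_ ?_
  · intro a b hab hb
    have ha4 : a < 4 := by omega
    by_cases hb4 : b < 4
    · simp only [hb4, ha4, if_true]
      obtain ⟨x, hx, y, hy, hxy⟩ := ha b hb4 a hab
      exact φ.joinedIn_drawingOn (connected_induce_union (hc a ha4).preconnected
        (hc b hb4).preconnected hy hx hxy.symm) (Or.inl (hs a ha4)) (Or.inr (hs b hb4))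
    · simp only [hb4, ha4, if_true, if_false]
      exact (φ.joinedIn_of_mem_frontier hw (hφ _)).symm
  · intro a b c d hab hb hcd hd5 hac had hbc hbd
    have ha4 : a < 4 := by omega
    have hc4 : c < 4 := by omega
    by_cases hb4 : b < 4 <;> by_cases hd4 : d < 4
    · simp only [hb4, hd4, if_true]
      refine φ.disjoint_drawingOn ?_
      simp only [Set.disjoint_union_left, Set.disjoint_union_right]
      exact ⟨⟨hd' ha4 hc4 hac, hd' hb4 hc4 hbc⟩, hd' ha4 hd4 had, hd' hb4 hd4 hbd⟩
    · simp only [hb4, hd4, if_true, if_false]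
      exact Set.disjoint_compl_right_iff_subset.2
        (φ.drawingOn_mono (hnot hc4 ha4 hb4 hac.symm hbc.symm))
    · simp only [hb4, hd4, if_true, if_false]
      exact Set.disjoint_compl_left_iff_subset.2 (φ.drawingOn_mono (hnot ha4 hc4 hd4 hac had))
    · omega

/-- The point `w` of the outer face joins the side of two, with index 0, and is connected to the
three branch sets opposite. -/
theorem IsOuterplanar.not_hasK23Minor [Finite V] (hG : G.IsOuterplanar) : ¬ G.HasK23Minor := by
  rintro ⟨T, hc, hd, ha⟩
  obtain ⟨φ, hφ⟩ := hG
  have hex (i : ℕ) : ∃ x, i < 6 → 1 ≤ i → x ∈ T i := by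
    by_cases hi : i < 6 ∧ 1 ≤ i
    · exact (exists_mem_of_connected_induce (hc i hi.1 hi.2)).imp fun x hx _ _ => hx
    · exact ⟨(exists_mem_of_connected_induce (hc 1 (by norm_num) le_rfl)).choose,
        fun h h' => absurd ⟨h, h'⟩ hi⟩
  choose s hs using hex
  obtain ⟨w, hw⟩ : φ.outerFace.Nonempty :=
    closure_nonempty_iff.1 ⟨_, frontier_subset_closure (hφ (s 0))⟩
  have hd' {i j : ℕ} (hi : i < 6) (hi1 : 1 ≤ i) (hj : j < 6) (hj1 : 1 ≤ j) (hij : i ≠ j) :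
      Disjoint (T i) (T j) := by
    rcases lt_or_gt_of_ne hij with h | h
    · exact (hd j hj i h hi1).symm
    · exact hd i hi j h hj1
  have hnot {i j k : ℕ} (hi : i < 6) (hi1 : 1 ≤ i) (hj : j < 6) (hj1 : 1 ≤ j) (hk : k < 6)
      (hk1 : 1 ≤ k) (hij : i ≠ j) (hik : i ≠ k) : T j ∪ T k ⊆ {s i}ᶜ := by
    rintro x hx rfl
    rcases hx with hx | hx
    · exact Set.disjoint_left.1 (hd' hi hi1 hj hj1 hij) (hs i hi hi1) hx
    · exact Set.disjoint_left.1 (hd' hi hi1 hk hk1 hik) (hs i hi hi1) hx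
  refine not_drawing_completeBipartiteGraph_three_three
    (fun i => if 1 ≤ i then φ.point (s i) else w)
    (fun a b => if 1 ≤ a then φ.drawingOn (T a ∪ T b) else (φ.drawingOn {s b}ᶜ)ᶜ) ?_ ?_
  · intro a b ha3 hb3 hb6
    have hb1 : 1 ≤ b := by omega
    by_cases ha1 : 1 ≤ a
    · simp only [ha1, hb1, if_true]
      obtain ⟨x, hx, y, hy, hxy⟩ := ha b hb6 hb3 a ha3 ha1
      exact φ.joinedIn_drawingOn (connected_induce_union (hc a (by omega) ha1).preconnected
        (hc b hb6 hb1).preconnected hy hx hxy.symm) (Or.inl (hs a (by omega) ha1))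
        (Or.inr (hs b hb6 hb1))
    · simp only [ha1, hb1, if_true, if_false]
      exact φ.joinedIn_of_mem_frontier hw (hφ _)
  · intro a b c d ha3 hb3 hb6 hc3 hd3 hd6 hac hbd
    have hb1 : 1 ≤ b := by omega
    have hd1 : 1 ≤ d := by omega
    have ha6 : a < 6 := by omega
    have hc6 : c < 6 := by omega
    by_cases ha1 : 1 ≤ a <;> by_cases hc1 : 1 ≤ c
    · simp only [ha1, hc1, if_true]
      refine φ.disjoint_drawingOn ?_
      simp only [Set.disjoint_union_left, Set.disjoint_union_right]
      exact ⟨⟨hd' ha6 ha1 hc6 hc1 hac, hd' hb6 hb1 hc6 hc1 (by omega)⟩,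
        hd' ha6 ha1 hd6 hd1 (by omega), hd' hb6 hb1 hd6 hd1 hbd⟩
    · simp only [ha1, hc1, if_true, if_false]
      exact Set.disjoint_compl_right_iff_subset.2
        (φ.drawingOn_mono (hnot hd6 hd1 ha6 ha1 hb6 hb1 (by omega) hbd.symm))
    · simp only [ha1, hc1, if_true, if_false]
      exact Set.disjoint_compl_left_iff_subset.2
        (φ.drawingOn_mono (hnot hb6 hb1 hc6 hc1 hd6 hd1 (by omega) hbd))
    · omega

end SimpleGraph

end

/-! ### Chordless cycles in graphs without these minors -/

namespace SimpleGraph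

variable {V : Type*} {G : SimpleGraph V}

lemma connected_induce_singleton (v : V) : (G.induce {v}).Connected := by
  have : Nonempty ({v} : Set V) := ⟨⟨v, rfl⟩⟩
  exact ⟨Preconnected.of_subsingleton⟩

/-- `S` is a connected set that avoids `p` and `q` and has neighbors of both. -/
def IsConnector (G : SimpleGraph V) (p q : V) (S : Set V) : Prop :=
  (G.induce S).Connected ∧ p ∉ S ∧ q ∉ S ∧ (∃ x ∈ S, G.Adj x p) ∧ ∃ x ∈ S, G.Adj x q

lemma hasK23Minor_of_isConnector {p q : V} (hpq : p ≠ q) {S₁ S₂ S₃ : Set V}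
    (h₁ : G.IsConnector p q S₁) (h₂ : G.IsConnector p q S₂) (h₃ : G.IsConnector p q S₃)
    (h₁₂ : Disjoint S₁ S₂) (h₁₃ : Disjoint S₁ S₃) (h₂₃ : Disjoint S₂ S₃) : G.HasK23Minor := by
  obtain ⟨c₁, p₁, q₁, ap₁, aq₁⟩ := h₁
  obtain ⟨c₂, p₂, q₂, ap₂, aq₂⟩ := h₂
  obtain ⟨c₃, p₃, q₃, ap₃, aq₃⟩ := h₃
  refine ⟨fun n => match n with
    | 1 => {p}
    | 2 => {q}
    | 3 => S₁
    | 4 => S₂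
    | _ => S₃, ?_, ?_, ?_⟩
  · intro i hi hi1
    interval_cases i <;> simp only [] <;>
      first | assumption | exact connected_induce_singleton _
  · intro i hi j hj hj1
    interval_cases i <;> interval_cases j <;>
      simp only [Set.disjoint_singleton_right, Set.mem_singleton_iff] <;>
      first | assumption | (apply Disjoint.symm; assumption)
  · intro i hi hi3 j hj hj1
    interval_cases i <;> interval_cases j <;> simpa

lemma hasK4Minor_of_triangle {x y z : V} (hxy : G.Adj x y) (hyz : G.Adj y z) (hxz : G.Adj x z)
    {S : Set V} (hS : (G.induce S).Connected) (hx : x ∉ S) (hy : y ∉ S) (hz : z ∉ S)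
    (ax : ∃ s ∈ S, G.Adj s x) (ay : ∃ s ∈ S, G.Adj s y) (az : ∃ s ∈ S, G.Adj s z) :
    G.HasK4Minor := by
  refine ⟨fun n => match n with
    | 0 => {x}
    | 1 => {y}
    | 2 => {z}
    | _ => S, ?_, ?_, ?_⟩
  · intro i hi
    interval_cases i <;> simp only [] <;>
      first | assumption | exact connected_induce_singleton _
  · intro i hi j hj
    interval_cases i <;> interval_cases j <;>
      simp only [Set.disjoint_singleton_right, Set.mem_singleton_iff] <;>
      first | assumption | exact hxy.ne | exact hyz.ne | exact hxz.ne
  · intro i hi j hj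
    interval_cases i <;> interval_cases j <;> simp [hxy.symm, hyz.symm, hxz.symm, ax, ay, az]

lemma exists_adj_boundary {A B : Set V} (hA : (G.induce A).Connected) (hBA : B ⊆ A) {x y : V}
    (hx : x ∈ B) (hy : y ∈ A) (hyB : y ∉ B) : ∃ u ∈ B, ∃ v ∈ A, v ∉ B ∧ G.Adj u v := by
  obtain ⟨p⟩ := hA.preconnected ⟨x, hBA hx⟩ ⟨y, hy⟩
  obtain ⟨d, -, h1, h2⟩ := p.exists_boundary_dart {z | z.1 ∈ B} hx hyB
  exact ⟨d.fst, h1, d.snd, d.snd.2, h2, d.adj⟩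

/-- The connected component of `x` in the subgraph induced by `S`. -/
lemma exists_component [Finite V] {S : Set V} {x : V} (hx : x ∈ S) :
    ∃ B ⊆ S, x ∈ B ∧ (G.induce B).Connected ∧ ∀ y ∈ B, ∀ z ∈ S, G.Adj y z → z ∈ B := by
  obtain ⟨B, hB⟩ := (Set.toFinite
    {B : Set V | B ⊆ S ∧ x ∈ B ∧ (G.induce B).Connected}).exists_maximal
    ⟨{x}, by simpa using hx, rfl, connected_induce_singleton x⟩
  refine ⟨B, hB.prop.1, hB.prop.2.1, hB.prop.2.2, fun y hy z hz hyz => ?_⟩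
  refine hB.le_of_ge (y := B ∪ {z}) ⟨?_, Or.inl hB.prop.2.1, ?_⟩ Set.subset_union_left
    (Or.inr rfl)
  · exact Set.union_subset hB.prop.1 (by simpa using hz)
  · exact connected_induce_union hB.prop.2.2.preconnected
      (connected_induce_singleton z).preconnected hy rfl hyz

/-- The vertices `q 0, …, q m` form a chordless cycle. -/
structure IsChordlessCycle (G : SimpleGraph V) (q : ℕ → V) (m : ℕ) : Prop where
  two_le : 2 ≤ m
  inj : ∀ i ≤ m, ∀ j ≤ m, q i = q j → i = j
  adj : ∀ i < m, G.Adj (q i) (q (i + 1))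
  adj_ends : G.Adj (q 0) (q m)
  chordless : ∀ i ≤ m, ∀ j ≤ m, G.Adj (q i) (q j) → i < j → j = i + 1 ∨ (i = 0 ∧ j = m)

namespace IsChordlessCycle

variable {q : ℕ → V} {m : ℕ}

lemma connected_Icc (h : G.IsChordlessCycle q m) {i j : ℕ} (hij : i ≤ j) (hj : j ≤ m) :
    (G.induce (q '' Set.Icc i j)).Connected := by
  induction j, hij using Nat.le_induction with
  | base =>
    rw [Set.Icc_self, Set.image_singleton]
    exact connected_induce_singleton (q i)
  | succ j hij ih =>
    have : q '' Set.Icc i (j + 1) = q '' Set.Icc i j ∪ {q (j + 1)} := by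
      rw [← Set.image_singleton, ← Set.image_union]
      congr 1
      ext k
      simp only [Set.mem_Icc, Set.mem_union, Set.mem_singleton_iff]
      omega
    rw [this]
    exact connected_induce_union (ih (by omega)).preconnected
      (connected_induce_singleton _).preconnected ⟨j, ⟨hij, le_rfl⟩, rfl⟩ rfl (h.adj j (by omega))

lemma notMem_image (h : G.IsChordlessCycle q m) {i : ℕ} (hi : i ≤ m) {s : Set ℕ}
    (hs : ∀ k ∈ s, k ≤ m) (his : i ∉ s) : q i ∉ q '' s := by
  rintro ⟨k, hk, hki⟩
  exact his (h.inj k (hs k hk) i hi hki ▸ hk)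

/-- Two nonconsecutive vertices cut the cycle into an inner and an outer arc: two of the three
connectors needed for a K₂,₃ minor. -/
lemma isConnector_inner (h : G.IsChordlessCycle q m) {i j : ℕ} (hij : i + 2 ≤ j) (hj : j ≤ m) :
    G.IsConnector (q i) (q j) (q '' Set.Icc (i + 1) (j - 1)) := by
  have hle : ∀ k ∈ Set.Icc (i + 1) (j - 1), k ≤ m := fun k hk => by
    simp only [Set.mem_Icc] at hk; omega
  refine ⟨h.connected_Icc (by omega) (by omega), h.notMem_image (by omega) hle ?_,
    h.notMem_image hj hle ?_, ⟨_, ⟨i + 1, ?_, rfl⟩, (h.adj i (by omega)).symm⟩,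
    ⟨_, ⟨j - 1, ?_, rfl⟩, ?_⟩⟩
  any_goals simp only [Set.mem_Icc]; omega
  have := h.adj (j - 1) (by omega)
  rwa [Nat.sub_add_cancel (by omega)] at this

lemma isConnector_outer (h : G.IsChordlessCycle q m) {i j : ℕ} (hij : i < j) (hj : j ≤ m)
    (h0 : ¬ (i = 0 ∧ j = m)) : G.IsConnector (q i) (q j) (q '' {k | k < i ∨ (j < k ∧ k ≤ m)}) := by
  have hle : ∀ k ∈ {k | k < i ∨ (j < k ∧ k ≤ m)}, k ≤ m := fun k hk => by
    simp only [Set.mem_ofPred_eq] at hk; omega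
  refine ⟨?_, h.notMem_image (by omega) hle ?_, h.notMem_image hj hle ?_, ?_, ?_⟩
  · rcases Nat.eq_zero_or_pos i with rfl | hi
    · have : {k | k < 0 ∨ (j < k ∧ k ≤ m)} = Set.Icc (j + 1) m := by
        ext k; simp only [Set.mem_ofPred_eq, Set.mem_Icc]; omega
      rw [this]
      exact h.connected_Icc (by omega) le_rfl
    rcases hj.eq_or_lt with rfl | hjm
    · have : {k | k < i ∨ (j < k ∧ k ≤ j)} = Set.Icc 0 (i - 1) := by
        ext k; simp only [Set.mem_ofPred_eq, Set.mem_Icc]; omega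
      rw [this]
      exact h.connected_Icc (by omega) (by omega)
    · have : {k | k < i ∨ (j < k ∧ k ≤ m)} = Set.Icc 0 (i - 1) ∪ Set.Icc (j + 1) m := by
        ext k; simp only [Set.mem_ofPred_eq, Set.mem_Icc, Set.mem_union]; omega
      rw [this, Set.image_union]
      exact connected_induce_union (h.connected_Icc (by omega) (by omega)).preconnected
        (h.connected_Icc (by omega) le_rfl).preconnected ⟨0, by simp, rfl⟩
        ⟨m, by simp only [Set.mem_Icc]; omega, rfl⟩ h.adj_ends
  · simp only [Set.mem_ofPred_eq]; omega
  · simp only [Set.mem_ofPred_eq]; omega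
  · rcases Nat.eq_zero_or_pos i with rfl | hi
    · exact ⟨q m, ⟨m, by simp only [Set.mem_ofPred_eq]; omega, rfl⟩, h.adj_ends.symm⟩
    · refine ⟨q (i - 1), ⟨i - 1, by simp only [Set.mem_ofPred_eq]; omega, rfl⟩, ?_⟩
      have := h.adj (i - 1) (by omega)
      rwa [Nat.sub_add_cancel hi] at this
  · rcases hj.eq_or_lt with rfl | hjm
    · exact ⟨q 0, ⟨0, by simp only [Set.mem_ofPred_eq]; omega, rfl⟩, h.adj_ends⟩
    · exact ⟨q (j + 1), ⟨j + 1, by simp only [Set.mem_ofPred_eq]; omega, rfl⟩, (h.adj j hjm).symm⟩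

lemma disjoint_image (h : G.IsChordlessCycle q m) {s t : Set ℕ} (hs : ∀ k ∈ s, k ≤ m)
    (ht : ∀ k ∈ t, k ≤ m) (hst : Disjoint s t) : Disjoint (q '' s) (q '' t) := by
  rw [Set.disjoint_left]
  rintro _ ⟨k, hk, rfl⟩
  exact h.notMem_image (hs k hk) ht (Set.disjoint_left.1 hst hk)

/-- A connected set outside a chordless cycle has no neighbors that are far apart on it. -/
lemma eq_succ_of_adj (h : G.IsChordlessCycle q m) (h23 : ¬ G.HasK23Minor) {B : Set V}
    (hB : (G.induce B).Connected) (hdisj : ∀ i ≤ m, q i ∉ B) {i j : ℕ} (hij : i < j) (hj : j ≤ m)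
    (hi' : ∃ x ∈ B, G.Adj x (q i)) (hj' : ∃ x ∈ B, G.Adj x (q j)) :
    j = i + 1 ∨ (i = 0 ∧ j = m) := by
  by_contra hcon
  push Not at hcon
  have hB' {s : Set ℕ} (hs : ∀ k ∈ s, k ≤ m) : Disjoint (q '' s) B := by
    rw [Set.disjoint_left]
    rintro _ ⟨k, hk, rfl⟩
    exact hdisj k (hs k hk)
  have hle1 : ∀ k ∈ Set.Icc (i + 1) (j - 1), k ≤ m := fun k hk => by
    simp only [Set.mem_Icc] at hk; omega
  have hle2 : ∀ k ∈ {k | k < i ∨ (j < k ∧ k ≤ m)}, k ≤ m := fun k hk => by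
    simp only [Set.mem_ofPred_eq] at hk; omega
  -- The third connector besides the two arcs is `B`.
  refine h23 (hasK23Minor_of_isConnector (fun e => hij.ne (h.inj i (by omega) j hj e))
    (h.isConnector_inner (by omega) hj) (h.isConnector_outer hij hj fun e => hcon.2 e.1 e.2)
    ⟨hB, hdisj i (by omega), hdisj j hj, hi', hj'⟩ (h.disjoint_image hle1 hle2 ?_) (hB' hle1)
    (hB' hle2))
  rw [Set.disjoint_left]
  intro k hk hk'
  simp only [Set.mem_Icc, Set.mem_ofPred_eq] at hk hk'
  omega

/-- A connected set outside a chordless cycle that has a neighbor on the cycle other than `q 0`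
and `q m` has all its neighbors on the cycle within one edge. -/
lemma exists_edge_of_adj (h : G.IsChordlessCycle q m) (h4 : ¬ G.HasK4Minor)
    (h23 : ¬ G.HasK23Minor) {B : Set V} (hB : (G.induce B).Connected) (hdisj : ∀ i ≤ m, q i ∉ B)
    {i : ℕ} (hi : 0 < i) (him : i < m) (hi' : ∃ x ∈ B, G.Adj x (q i)) :
    ∃ l < m, (l = i ∨ l + 1 = i) ∧ ∀ j ≤ m, (∃ x ∈ B, G.Adj x (q j)) → j = l ∨ j = l + 1 := by
  have near : ∀ j ≤ m, (∃ x ∈ B, G.Adj x (q j)) → j + 1 = i ∨ j = i ∨ j = i + 1 := by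
    intro j hj hj'
    rcases lt_trichotomy i j with hij | hij | hij
    · have := h.eq_succ_of_adj h23 hB hdisj hij hj hi' hj'
      omega
    · omega
    · have := h.eq_succ_of_adj h23 hB hdisj hij him.le hj' hi'
      omega
  by_cases hl : ∃ x ∈ B, G.Adj x (q (i - 1))
  · refine ⟨i - 1, by omega, by omega, fun j hj hj' => ?_⟩
    have := near j hj hj'
    suffices j ≠ i + 1 by omega
    rintro rfl
    -- Neighbors on both sides of `q i` must be consecutive through the closing edge, so the cycle
    -- is a triangle and forms a K₄ minor with `B`.
    have := h.eq_succ_of_adj h23 hB hdisj (by omega : i - 1 < i + 1) hj hl hj'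
    obtain rfl : i = 1 := by omega
    obtain rfl : m = 2 := by omega
    exact h4 (hasK4Minor_of_triangle (h.adj 0 (by omega)) (h.adj 1 (by omega)) h.adj_ends hB
      (hdisj 0 (by omega)) (hdisj 1 (by omega)) (hdisj 2 le_rfl) hl hi' hj')
  · refine ⟨i, him, Or.inl rfl, fun j hj hj' => ?_⟩
    have := near j hj hj'
    suffices j + 1 ≠ i by omega
    rintro rfl
    exact hl (by simpa using hj')

/-- There is at most one vertex outside the cycle adjacent to both ends of an edge of the cycle. -/
lemma eq_of_adj_adj (h : G.IsChordlessCycle q m) (h23 : ¬ G.HasK23Minor) {l : ℕ} (hl : l < m)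
    {u u' : V} (hu : ∀ i ≤ m, q i ≠ u) (hu' : ∀ i ≤ m, q i ≠ u')
    (h1 : G.Adj u (q l)) (h2 : G.Adj u (q (l + 1))) (h3 : G.Adj u' (q l))
    (h4 : G.Adj u' (q (l + 1))) : u = u' := by
  by_contra hne
  have hm := h.two_le
  have br {u : V} (h1 : G.Adj u (q l)) (h2 : G.Adj u (q (l + 1))) :
      G.IsConnector (q l) (q (l + 1)) {u} :=
    ⟨connected_induce_singleton u, h1.ne', h2.ne', by simpa, by simpa⟩
  have hd {u : V} (hu : ∀ i ≤ m, q i ≠ u) :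
      Disjoint (q '' {k | k < l ∨ (l + 1 < k ∧ k ≤ m)}) {u} := by
    rw [Set.disjoint_singleton_right]
    rintro ⟨k, hk, hku⟩
    simp only [Set.mem_ofPred_eq] at hk
    exact hu k (by omega) hku
  exact h23 (hasK23Minor_of_isConnector (h.adj l hl).ne
    (h.isConnector_outer (by omega) (by omega) (by omega)) (br h1 h2) (br h3 h4) (hd hu) (hd hu')
    (by simpa using hne))

end IsChordlessCycle

/-- If a connected set `A` has neighbors of both ends of an edge `ab`, then the edge lies on a
chordless cycle through `A`. -/
lemma exists_isChordlessCycle {A : Set V} (hA : (G.induce A).Connected) {a b : V} (ha : a ∉ A)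
    (hb : b ∉ A) (hab : G.Adj a b) (ha' : ∃ x ∈ A, G.Adj x a) (hb' : ∃ x ∈ A, G.Adj x b) :
    ∃ q m, G.IsChordlessCycle q m ∧ q 0 = a ∧ q m = b ∧ ∀ i, 0 < i → i < m → q i ∈ A := by
  -- `K` is the graph on `A`, `a`, `b` without the edge `ab`. A shortest path from `a` to `b` in `K`
  -- closes with `ab` to a chordless cycle, since a chord would be a shortcut.
  let K : SimpleGraph V := (G.deleteEdges {s(a, b)}) ⊓ (SimpleGraph.fromRel fun x y =>
    (x ∈ A ∨ x = a ∨ x = b) ∧ (y ∈ A ∨ y = a ∨ y = b))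
  have hK (x y : V) : K.Adj x y ↔ G.Adj x y ∧ s(x, y) ≠ s(a, b) ∧ (x ∈ A ∨ x = a ∨ x = b) ∧
      (y ∈ A ∨ y = a ∨ y = b) := by
    simp only [K, inf_adj, deleteEdges_adj, fromRel_adj, Set.mem_singleton_iff]
    constructor
    · tauto
    · exact fun h => ⟨⟨h.1, h.2.1⟩, h.1.ne, Or.inl h.2.2⟩
  have hne {x y : V} (hx : x ∈ A) : s(x, y) ≠ s(a, b) := by
    intro e
    rcases Sym2.eq_iff.1 e with ⟨rfl, -⟩ | ⟨rfl, -⟩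
    · exact ha hx
    · exact hb hx
  obtain ⟨x, hx, hxa⟩ := ha'
  obtain ⟨y, hy, hyb⟩ := hb'
  have hreach : K.Reachable a b := by
    have h1 : K.Adj x a := (hK _ _).2 ⟨hxa, hne hx, by tauto, by tauto⟩
    have h2 : K.Adj y b := (hK _ _).2 ⟨hyb, hne hy, by tauto, by tauto⟩
    have h3 : K.Reachable x y := by
      let f : G.induce A →g K :=
        ⟨fun v => v.1, fun {v w} h => (hK _ _).2 ⟨h, hne v.2, Or.inl v.2, Or.inl w.2⟩⟩
      exact (hA.preconnected ⟨x, hx⟩ ⟨y, hy⟩).map f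
    exact (h1.symm.reachable.trans h3).trans h2.reachable
  obtain ⟨p, hp⟩ := hreach.exists_walk_length_eq_dist
  have hp0 : p.getVert 0 = a := p.getVert_zero
  have hpm : p.getVert p.length = b := p.getVert_length
  have hr (i : ℕ) : K.Reachable a (p.getVert i) := ⟨p.take i⟩
  have hdist (i : ℕ) (hi : i ≤ p.length) : K.dist a (p.getVert i) = i := by
    have h1 : K.dist a (p.getVert i) ≤ i := (dist_le (p.take i)).trans (by simp [Walk.take_length])
    have h2 : K.dist (p.getVert i) b ≤ p.length - i :=
      (dist_le (p.drop i)).trans (by simp [Walk.drop_length])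
    have h3 := (hr i).dist_triangle_left b
    omega
  have hinj : ∀ i ≤ p.length, ∀ j ≤ p.length, p.getVert i = p.getVert j → i = j := by
    intro i hi j hj e
    rw [← hdist i hi, ← hdist j hj, e]
  have hadj : ∀ i < p.length, K.Adj (p.getVert i) (p.getVert (i + 1)) :=
    fun i hi => p.adj_getVert_succ hi
  have hmem : ∀ i ≤ p.length, p.getVert i ∈ A ∨ p.getVert i = a ∨ p.getVert i = b := by
    intro i hi
    rcases hi.eq_or_lt with rfl | hi
    · exact Or.inr (Or.inr hpm)
    · exact ((hK _ _).1 (hadj i hi)).2.2.1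
  have h2 : 2 ≤ p.length := by
    by_contra hlt
    have h1 : p.length = 0 ∨ p.length = 1 := by omega
    rcases h1 with h1 | h1
    · rw [h1, hp0] at hpm
      exact hab.ne hpm
    · have := hadj 0 (by omega)
      rw [zero_add, ← h1, hpm, hp0] at this
      exact ((hK _ _).1 this).2.1 rfl
  refine ⟨p.getVert, p.length, ⟨h2, hinj, fun i hi => ((hK _ _).1 (hadj i hi)).1, ?_, ?_⟩, hp0,
    hpm, ?_⟩
  · rwa [hp0, hpm]
  · intro i hi j hj hij hlt
    by_cases e : s(p.getVert i, p.getVert j) = s(a, b)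
    · right
      rcases Sym2.eq_iff.1 e with ⟨e1, e2⟩ | ⟨e1, e2⟩
      · exact ⟨hinj _ hi _ (by omega) (e1.trans hp0.symm), hinj _ hj _ le_rfl (e2.trans hpm.symm)⟩
      · have := hinj _ hi _ le_rfl (e1.trans hpm.symm)
        omega
    · left
      have hKij : K.Adj (p.getVert i) (p.getVert j) := (hK _ _).2 ⟨hij, e, hmem i hi, hmem j hj⟩
      have h3 := (hr i).dist_triangle_left (p.getVert j)
      rw [hdist i hi, hdist j hj, dist_eq_one_iff_adj.2 hKij] at h3
      omega
  · intro i hi him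
    rcases hmem i him.le with h | h | h
    · exact h
    · have := hinj i him.le 0 (by omega) (h.trans hp0.symm)
      omega
    · have := hinj i him.le _ le_rfl (h.trans hpm.symm)
      omega

end SimpleGraph

/-! ### Minimal pockets and reducible configurations -/

namespace SimpleGraph

variable {V : Type*} {G : SimpleGraph V}

lemma ncard_pair_le_two (x y : V) : ({x, y} : Set V).ncard ≤ 2 :=
  (Set.ncard_insert_le x {y}).trans (by rw [Set.ncard_singleton])

/-- A connected set of at least two vertices that is attached to the rest of the graph only at a
vertex or at the two ends of an edge. -/
def IsPocket (G : SimpleGraph V) (A : Set V) : Prop :=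
  (G.induce A).Connected ∧ A.Nontrivial ∧ ∃ a b, a ∉ A ∧ b ∉ A ∧ (a = b ∨ G.Adj a b) ∧
    ∀ x ∈ A, ∀ y, G.Adj x y → y ∈ A ∨ y = a ∨ y = b

/-- The component of `y` after removal of `x` is attached only at `x`, and it has a second vertex
because `y` is not a leaf. -/
lemma exists_isPocket [Finite V] (hdeg : ∀ x y, G.Adj x y → ∃ z ≠ y, G.Adj x z) {x y : V}
    (hxy : G.Adj x y) : ∃ A, G.IsPocket A := by
  obtain ⟨B, hBS, hyB, hB, hcl⟩ := exists_component (G := G) (S := {x}ᶜ) (x := y) hxy.ne'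
  obtain ⟨z, hzx, hyz⟩ := hdeg y x hxy.symm
  refine ⟨B, hB, ⟨y, hyB, z, hcl y hyB z hzx hyz, hyz.ne⟩, x, x, fun h => hBS h rfl,
    fun h => hBS h rfl, Or.inl rfl, fun u hu v huv => ?_⟩
  by_cases hv : v = x
  · exact Or.inr (Or.inl hv)
  · exact Or.inl (hcl u hu v hv huv)

/-- In a minimal pocket, a proper connected subset attached to a vertex or to an edge is a single
vertex adjacent to exactly the two ends of the edge. -/
lemma IsPocket.eq_singleton_of_ssubset {A : Set V} (hA : Minimal G.IsPocket A)
    (hdeg : ∀ x y, G.Adj x y → ∃ z ≠ y, G.Adj x z) {B : Set V} (hBA : B ⊂ A)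
    (hB : (G.induce B).Connected) {c d : V} (hc : c ∉ B) (hd : d ∉ B) (hcd : c = d ∨ G.Adj c d)
    (hN : ∀ x ∈ B, ∀ y, G.Adj x y → y ∈ B ∨ y = c ∨ y = d) {u : V} (hu : u ∈ B) :
    B = {u} ∧ G.neighborSet u = {c, d} ∧ G.Adj c d := by
  have hsub : B.Subsingleton := by
    rw [← Set.not_nontrivial_iff]
    intro hnt
    exact hBA.2 (hA.le_of_le ⟨hB, hnt, c, d, hc, hd, hcd, hN⟩ hBA.1)
  have hBu : B = {u} := hsub.eq_singleton_of_mem hu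
  obtain ⟨w, hw, hwB⟩ := Set.exists_of_ssubset hBA
  obtain ⟨u', hu', v, -, -, huv⟩ := exists_adj_boundary hA.prop.1 hBA.1 hu hw hwB
  rw [hBu, Set.mem_singleton_iff] at hu'
  subst hu'
  -- A second neighbor exists since there are no leaves; as both lie in `{c, d}`, this forces `c ≠
  -- d`.
  obtain ⟨z, hzv, huz⟩ := hdeg _ _ huv
  have key (y : V) (hy : G.Adj u' y) : y = c ∨ y = d := by
    refine (hN u' hu y hy).resolve_left fun h => hy.ne ?_
    rw [hBu, Set.mem_singleton_iff] at h
    exact h.symm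
  have hne : c ≠ d := by
    rintro rfl
    exact hzv (((key z huz).elim id id).trans ((key v huv).elim id id).symm)
  refine ⟨hBu, Set.Subset.antisymm (fun y hy => key y hy) ?_, hcd.resolve_left hne⟩
  have hc' : G.Adj u' c := by
    rcases key v huv with rfl | rfl
    · exact huv
    · rcases key z huz with rfl | rfl
      · exact huz
      · exact absurd rfl hzv
  have hd' : G.Adj u' d := by
    rcases key v huv with rfl | rfl
    · rcases key z huz with rfl | rfl
      · exact absurd rfl hzv
      · exact huz
    · exact huv
  rintro y (rfl | rfl)
  · exact hc'
  · exact hd'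

/-- A graph has one of the configurations that are reducible for colorings of edges. -/
def HasReducibleConfiguration (G : SimpleGraph V) : Prop :=
  (∃ x u v w z, u ≠ w ∧ G.neighborSet u = {x, v} ∧ G.neighborSet v = {u, w} ∧
      G.neighborSet w = {v, z}) ∨
    (∃ x u v z, G.neighborSet u = {x, v} ∧ G.neighborSet v = {u, z} ∧ G.Adj x z) ∨
    ∃ u v w, G.neighborSet u = {v, w} ∧ G.Adj v w ∧ (G.neighborSet v).ncard ≤ 4

/-- A minimal pocket attached to at most one vertex. -/
lemma IsPocket.hasReducibleConfiguration_of_cut [Finite V] (h23 : ¬ G.HasK23Minor)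
    (hdeg : ∀ x y, G.Adj x y → ∃ z ≠ y, G.Adj x z) {A : Set V} (hA : Minimal G.IsPocket A) {a : V}
    (ha : a ∉ A) (hN : ∀ x ∈ A, ∀ y, G.Adj x y → y ∈ A ∨ y = a) :
    G.HasReducibleConfiguration := by
  obtain ⟨y, hyA, hya⟩ : ∃ y ∈ A, (∃ x ∈ A, G.Adj x a) → G.Adj y a := by
    by_cases h : ∃ x ∈ A, G.Adj x a
    · obtain ⟨x, hx, hxa⟩ := h
      exact ⟨x, hx, fun _ => hxa⟩
    · obtain ⟨x, hx⟩ := hA.prop.2.1.nonempty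
      exact ⟨x, hx, fun h' => absurd h' h⟩
  -- The component of `u` in `A` without `y` is attached at the edge `ay`, or at `y` alone if `A`
  -- has no neighbor of `a`. Minimality makes it a single vertex in the first case and is
  -- contradicted in the second.
  have key : ∀ u ∈ A, u ≠ y → G.neighborSet u = {a, y} ∧ G.Adj a y := by
    intro u hu huy
    obtain ⟨B, hBS, huB, hB, hcl⟩ := exists_component (G := G) (S := A \ {y}) ⟨hu, huy⟩
    have hBA : B ⊂ A := ⟨fun x hx => (hBS hx).1, fun h => (hBS (h hyA)).2 rfl⟩
    have hyB : y ∉ B := fun h => (hBS h).2 rfl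
    have haB : a ∉ B := fun h => ha (hBS h).1
    have hclB : ∀ x ∈ B, ∀ z, G.Adj x z → z ∈ B ∨ z = a ∨ z = y := by
      intro x hx z hxz
      rcases hN x (hBS hx).1 z hxz with hz | hz
      · by_cases hzy : z = y
        · exact Or.inr (Or.inr hzy)
        · exact Or.inl (hcl x hx z ⟨hz, hzy⟩ hxz)
      · exact Or.inr (Or.inl hz)
    by_cases hat : ∃ x ∈ A, G.Adj x a
    · exact (eq_singleton_of_ssubset hA hdeg hBA hB haB hyB (Or.inr (hya hat).symm) hclB huB).2
    · refine absurd (eq_singleton_of_ssubset hA hdeg hBA hB hyB hyB (Or.inl rfl)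
        (fun x hx z hxz => ?_) huB).2.2 (G.loopless.irrefl y)
      rcases hclB x hx z hxz with h | rfl | h
      · exact Or.inl h
      · exact absurd ⟨x, (hBS hx).1, hxz⟩ hat
      · exact Or.inr (Or.inl h)
  obtain ⟨u, hu, huy⟩ := hA.prop.2.1.exists_ne y
  obtain ⟨hNu, hay⟩ := key u hu huy
  refine Or.inr (Or.inr ⟨u, y, a, by rw [hNu, Set.pair_comm], hay.symm, ?_⟩)
  -- With five neighbors, `y` would have three in `A`, all adjacent to `a` as well: a K₂,₃ minor.
  by_contra hcard
  have hsub : G.neighborSet y ⊆ insert a (A \ {y}) := by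
    intro z hz
    rcases hN y hyA z hz with h | h
    · exact Or.inr ⟨h, fun e => G.loopless.irrefl y (e ▸ hz : G.Adj y y)⟩
    · exact Or.inl h
  have h1 := (Set.ncard_le_ncard hsub).trans (Set.ncard_insert_le _ _)
  obtain ⟨u₁, u₂, u₃, h₁, h₂, h₃, h₁₂, h₁₃, h₂₃⟩ :=
    (Set.two_lt_ncard_iff (s := A \ {y})).1 (by omega)
  have br {u : V} (hu : u ∈ A \ {y}) : G.IsConnector a y {u} := by
    have hNu := (key u hu.1 hu.2).1
    have h1 : G.Adj u a := by
      rw [← mem_neighborSet, hNu]; simp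
    have h2 : G.Adj u y := by
      rw [← mem_neighborSet, hNu]; simp
    exact ⟨connected_induce_singleton u, h1.ne', h2.ne', by simpa, by simpa⟩
  exact h23 (hasK23Minor_of_isConnector hay.ne (br h₁) (br h₂) (br h₃) (by simpa) (by simpa)
    (by simpa))

/-- A minimal pocket attached to both ends of an edge. -/
lemma IsPocket.hasReducibleConfiguration_of_adj [Finite V] (h4 : ¬ G.HasK4Minor)
    (h23 : ¬ G.HasK23Minor) (hdeg : ∀ x y, G.Adj x y → ∃ z ≠ y, G.Adj x z) {A : Set V}
    (hA : Minimal G.IsPocket A) {a b : V} (ha : a ∉ A) (hb : b ∉ A) (hab : G.Adj a b)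
    (hN : ∀ x ∈ A, ∀ y, G.Adj x y → y ∈ A ∨ y = a ∨ y = b) (ha' : ∃ x ∈ A, G.Adj x a)
    (hb' : ∃ x ∈ A, G.Adj x b) : G.HasReducibleConfiguration := by
  obtain ⟨q, m, hq, hq0, hqm, hqA⟩ := exists_isChordlessCycle hA.prop.1 ha hb hab ha' hb'
  have hm := hq.two_le
  have hNq : ∀ x ∈ A, ∀ y, G.Adj x y → y ∈ A ∨ ∃ i ≤ m, y = q i := by
    intro x hx y hxy
    rcases hN x hx y hxy with h | rfl | rfl
    · exact Or.inl h
    · exact Or.inr ⟨0, by omega, hq0.symm⟩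
    · exact Or.inr ⟨m, le_rfl, hqm.symm⟩
  -- A component `B` of `A` off the cycle has a neighbor `q i` with `0 < i < m` because `A` is
  -- connected. So its neighbors on the cycle lie within one edge other than `ab`, and minimality
  -- makes `B` an ear.
  have key : ∀ u ∈ A, (∀ i ≤ m, q i ≠ u) → ∃ l < m, G.neighborSet u = {q l, q (l + 1)} := by
    intro u hu hqu
    obtain ⟨B, hBS, huB, hB, hcl⟩ := exists_component (G := G)
      (S := A \ {v | ∃ i ≤ m, q i = v}) ⟨hu, fun ⟨i, hi, h⟩ => hqu i hi h⟩
    have hdisj : ∀ i ≤ m, q i ∉ B := fun i hi h => (hBS h).2 ⟨i, hi, rfl⟩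
    have hBA : B ⊂ A := ⟨fun x hx => (hBS hx).1,
      fun h => hdisj 1 (by omega) (h (hqA 1 (by omega) (by omega)))⟩
    have hclB : ∀ x ∈ B, ∀ y, G.Adj x y → y ∈ B ∨ ∃ i ≤ m, y = q i := by
      intro x hx y hxy
      by_cases hy : ∃ i ≤ m, y = q i
      · exact Or.inr hy
      · refine Or.inl (hcl x hx y ⟨(hNq x (hBS hx).1 y hxy).resolve_right hy, ?_⟩ hxy)
        rintro ⟨i, hi, h⟩
        exact hy ⟨i, hi, h.symm⟩
    obtain ⟨w, hw, hwB⟩ := Set.exists_of_ssubset hBA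
    obtain ⟨x, hx, y, hyA, hyB, hxy⟩ := exists_adj_boundary hA.prop.1 hBA.1 huB hw hwB
    obtain ⟨i, hi, rfl⟩ := (hclB x hx y hxy).resolve_left hyB
    have hi0 : 0 < i := Nat.pos_of_ne_zero fun h => ha (by rwa [h, hq0] at hyA)
    have him : i < m := lt_of_le_of_ne hi fun h => hb (by rwa [h, hqm] at hyA)
    obtain ⟨l, hl, -, hnear⟩ := hq.exists_edge_of_adj h4 h23 hB hdisj hi0 him ⟨x, hx, hxy⟩
    refine ⟨l, hl, (eq_singleton_of_ssubset hA hdeg hBA hB (hdisj l hl.le) (hdisj (l + 1) hl)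
      (Or.inr (hq.adj l hl)) (fun x hx y hxy => ?_) huB).2.1⟩
    rcases hclB x hx y hxy with h | ⟨j, hj, rfl⟩
    · exact Or.inl h
    · rcases hnear j hj ⟨x, hx, hxy⟩ with rfl | rfl <;> simp
  have hon : ∀ i, 0 < i → i < m → ∀ j ≤ m, G.Adj (q i) (q j) → j = i + 1 ∨ j = i - 1 := by
    intro i hi him j hj hij
    rcases lt_trichotomy i j with h | h | h
    · have := hq.chordless i him.le j hj hij h
      omega
    · subst h
      exact absurd hij (G.loopless.irrefl _)
    · have := hq.chordless j hj i him.le hij.symm h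
      omega
  have hpred : ∀ i, 0 < i → i < m → G.Adj (q i) (q (i - 1)) := by
    intro i hi him
    have := hq.adj (i - 1) (by omega)
    rw [Nat.sub_add_cancel hi] at this
    exact this.symm
  by_cases hout : ∃ u ∈ A, ∀ i ≤ m, q i ≠ u
  -- Two neighbors on the cycle, and at most one ear over each of the two cycle edges at `q i`.
  · have hcard : ∀ i, 0 < i → i < m → (G.neighborSet (q i)).ncard ≤ 4 := by
      intro i hi him
      have hsplit : G.neighborSet (q i) ⊆ {q (i - 1), q (i + 1)} ∪
          ({u | (∀ j ≤ m, q j ≠ u) ∧ G.neighborSet u = {q (i - 1), q i}} ∪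
            {u | (∀ j ≤ m, q j ≠ u) ∧ G.neighborSet u = {q i, q (i + 1)}}) := by
        intro y hy
        by_cases hyq : ∃ j ≤ m, y = q j
        · obtain ⟨j, hj, rfl⟩ := hyq
          rcases hon i hi him j hj hy with rfl | rfl <;> simp
        · have hyA := (hNq _ (hqA i hi him) y hy).resolve_right hyq
          have hyq' : ∀ j ≤ m, q j ≠ y := fun j hj h => hyq ⟨j, hj, h.symm⟩
          obtain ⟨l, hl, hNy⟩ := key y hyA hyq'
          have : q i ∈ G.neighborSet y := (show G.Adj (q i) y from hy).symm
          rw [hNy] at this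
          rcases this with h | h
          · obtain rfl := hq.inj i him.le l hl.le h
            exact Or.inr (Or.inr ⟨hyq', hNy⟩)
          · obtain rfl := hq.inj i him.le (l + 1) hl h
            exact Or.inr (Or.inl ⟨hyq', by simpa using hNy⟩)
      have hone : ∀ l < m,
          {u | (∀ j ≤ m, q j ≠ u) ∧ G.neighborSet u = {q l, q (l + 1)}}.ncard ≤ 1 := by
        intro l hl
        rw [Set.ncard_le_one_iff]
        rintro u u' ⟨hu, hNu⟩ ⟨hu', hNu'⟩
        have h1 {u : V} (h : G.neighborSet u = {q l, q (l + 1)}) :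
            G.Adj u (q l) ∧ G.Adj u (q (l + 1)) := by
          rw [← mem_neighborSet, ← mem_neighborSet, h]; simp
        exact hq.eq_of_adj_adj h23 hl hu hu' (h1 hNu).1 (h1 hNu).2 (h1 hNu').1 (h1 hNu').2
      have hl := hone (i - 1) (by omega)
      rw [Nat.sub_add_cancel hi] at hl
      have hr := hone i him
      have h2 := ncard_pair_le_two (q (i - 1)) (q (i + 1))
      refine (Set.ncard_le_ncard hsplit).trans ((Set.ncard_union_le _ _).trans ?_)
      have := Set.ncard_union_le
        {u | (∀ j ≤ m, q j ≠ u) ∧ G.neighborSet u = {q (i - 1), q i}}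
        {u | (∀ j ≤ m, q j ≠ u) ∧ G.neighborSet u = {q i, q (i + 1)}}
      omega
    obtain ⟨u, hu, hqu⟩ := hout
    obtain ⟨l, hl, hNu⟩ := key u hu hqu
    -- The degree of `q 0 = a` is not controlled, so for `l = 0` the other end `q 1` is the vertex
    -- of small degree.
    rcases Nat.eq_zero_or_pos l with rfl | hl0
    · exact Or.inr (Or.inr ⟨u, q 1, q 0, by rw [hNu, Set.pair_comm], (hq.adj 0 hl).symm,
        hcard 1 one_pos (by omega)⟩)
    · exact Or.inr (Or.inr ⟨u, q l, q (l + 1), hNu, hq.adj l hl, hcard l hl0 hl⟩)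
  · push Not at hout
    have hNq2 : ∀ i, 0 < i → i < m → G.neighborSet (q i) = {q (i - 1), q (i + 1)} := by
      intro i hi him
      apply Set.Subset.antisymm
      · intro y hy
        obtain ⟨j, hj, rfl⟩ : ∃ j ≤ m, y = q j := by
          rcases hNq _ (hqA i hi him) y hy with h | h
          · obtain ⟨j, hj, h⟩ := hout y h
            exact ⟨j, hj, h.symm⟩
          · exact h
        rcases hon i hi him j hj hy with rfl | rfl <;> simp
      · rintro y (rfl | rfl)
        · exact hpred i hi him
        · exact hq.adj i him
    -- `A` has at least two vertices, and all of them are inner vertices `q 1, …, q (m - 1)`.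
    have hm3 : 3 ≤ m := by
      obtain ⟨x, hx, hx1⟩ := hA.prop.2.1.exists_ne (q 1)
      obtain ⟨j, hj, rfl⟩ := hout x hx
      have : j ≠ 0 := fun h => ha (by rwa [h, hq0] at hx)
      have : j ≠ m := fun h => hb (by rwa [h, hqm] at hx)
      have : j ≠ 1 := fun h => hx1 (by rw [h])
      omega
    rcases hm3.eq_or_lt with h3 | h3
    · refine Or.inr (Or.inl ⟨q 0, q 1, q 2, q 3, hNq2 1 one_pos (by omega),
        hNq2 2 two_pos (by omega), ?_⟩)
      rw [h3]
      exact hq.adj_ends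
    · exact Or.inl ⟨q 0, q 1, q 2, q 3, q 4,
        fun h => absurd (hq.inj 1 (by omega) 3 (by omega) h) (by norm_num), hNq2 1 one_pos (by omega),
        hNq2 2 two_pos (by omega), hNq2 3 (by omega) (by omega)⟩

theorem hasReducibleConfiguration [Finite V] (h4 : ¬ G.HasK4Minor) (h23 : ¬ G.HasK23Minor)
    (hdeg : ∀ x y, G.Adj x y → ∃ z ≠ y, G.Adj x z) {x y : V} (hxy : G.Adj x y) :
    G.HasReducibleConfiguration := by
  obtain ⟨A, hA⟩ := (Set.toFinite {A | G.IsPocket A}).exists_minimal (exists_isPocket hdeg hxy)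
  replace hA : Minimal G.IsPocket A := hA
  obtain ⟨a, b, ha, hb, hab, hN⟩ := hA.prop.2.2
  by_cases ha' : ∃ x ∈ A, G.Adj x a
  · by_cases hb' : ∃ x ∈ A, G.Adj x b
    · rcases hab with rfl | hab
      · exact IsPocket.hasReducibleConfiguration_of_cut h23 hdeg hA ha
          fun x hx y hxy => by simpa using hN x hx y hxy
      · exact IsPocket.hasReducibleConfiguration_of_adj h4 h23 hdeg hA ha hb hab hN ha' hb'
    · refine IsPocket.hasReducibleConfiguration_of_cut h23 hdeg hA ha fun x hx y hxy => ?_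
      rcases hN x hx y hxy with h | h | rfl
      · exact Or.inl h
      · exact Or.inr h
      · exact absurd ⟨x, hx, hxy⟩ hb'
  · refine IsPocket.hasReducibleConfiguration_of_cut h23 hdeg hA hb fun x hx y hxy => ?_
    rcases hN x hx y hxy with h | rfl | h
    · exact Or.inl h
    · exact absurd ⟨x, hx, hxy⟩ ha'
    · exact Or.inr h

end SimpleGraph

/-! ### Extending partial colorings by counting -/

namespace SimpleGraph

variable {V : Type*} {G : SimpleGraph V}

/-- A labelling of the edges in `F` by sets of two colors from `{1, …, k}` such that edges with a
common end have disjoint labels and edges joined by an edge of `G` have different labels. -/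
structure IsPartialColoring (G : SimpleGraph V) (k : ℕ) (F : Set (Sym2 V))
    (f : Sym2 V → Finset ℕ) : Prop where
  mem : ∀ e ∈ F, f e ∈ Finset.powersetCard 2 (Finset.Icc 1 k)
  disj : ∀ x y z, s(x, y) ∈ F → s(x, z) ∈ F → y ≠ z → Disjoint (f s(x, y)) (f s(x, z))
  ne : ∀ w x y z, s(w, x) ∈ F → s(y, z) ∈ F → G.Adj x y → s(w, x) ≠ s(y, z) →
    f s(w, x) ≠ f s(y, z)

/-- A partial coloring extends to the edge `uv` if there are few edges near it. The set `Y`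
contains all neighbors of `u` and `v` that have neighbors other than `u` and `v`. -/
lemma IsPartialColoring.exists_insert [Finite V] {D k : ℕ}
    (hD : ∀ v, (G.neighborSet v).ncard ≤ D) {F : Set (Sym2 V)} {f : Sym2 V → Finset ℕ}
    (h : G.IsPartialColoring k F f) (hF : F ⊆ G.edgeSet) {u v : V} (huv : G.Adj u v)
    (hnot : s(u, v) ∉ F) {Y : Set V}
    (hY : ∀ x y z, x = u ∨ x = v → G.Adj x y → G.Adj y z → y ≠ u → y ≠ v → z ≠ u → z ≠ v → y ∈ Y)
    (hcount : Y.ncard * D <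
      (k - 2 * ((G.neighborSet u).ncard + (G.neighborSet v).ncard - 2)).choose 2) :
    ∃ f', G.IsPartialColoring k (insert s(u, v) F) f' := by
  classical
  have := Fintype.ofFinite V
  -- `A` consists of the colored edges adjacent to `uv`, whose colors `X` are forbidden. The set `B`
  -- below contains the remaining colored edges joined to `uv`; each of these forbids only one pair.
  set A : Finset (Sym2 V) := (((G.neighborSet u).toFinset.erase v).image (s(u, ·)) ∪
    ((G.neighborSet v).toFinset.erase u).image (s(v, ·))).filter (· ∈ F) with hA
  have hAcard : A.card ≤ (G.neighborSet u).ncard + (G.neighborSet v).ncard - 2 := by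
    have h1 := Finset.card_erase_of_mem (s := (G.neighborSet u).toFinset) (a := v) (by simpa)
    have h2 := Finset.card_erase_of_mem (s := (G.neighborSet v).toFinset) (a := u)
      (by simpa using huv.symm)
    have h3 : 0 < (G.neighborSet u).toFinset.card := Finset.card_pos.2 ⟨v, by simpa⟩
    have h4 : 0 < (G.neighborSet v).toFinset.card := Finset.card_pos.2 ⟨u, by simpa using huv.symm⟩
    have h5 := Finset.card_union_le (((G.neighborSet u).toFinset.erase v).image (s(u, ·)))
      (((G.neighborSet v).toFinset.erase u).image (s(v, ·)))
    have h6 := Finset.card_image_le (s := (G.neighborSet u).toFinset.erase v) (f := (s(u, ·)))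
    have h7 := Finset.card_image_le (s := (G.neighborSet v).toFinset.erase u) (f := (s(v, ·)))
    have h8 : A.card ≤ _ := Finset.card_filter_le _ _
    rw [Set.ncard_eq_toFinset_card', Set.ncard_eq_toFinset_card']
    omega
  have hmemA : ∀ x y, x = u ∨ x = v → s(x, y) ∈ F → s(x, y) ∈ A := by
    intro x y hx hxy
    have hadj : G.Adj x y := hF hxy
    rw [hA, Finset.mem_filter, Finset.mem_union, Finset.mem_image, Finset.mem_image]
    refine ⟨?_, hxy⟩
    rcases hx with rfl | rfl
    · refine Or.inl ⟨y, Finset.mem_erase.2 ⟨?_, by simpa⟩, rfl⟩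
      rintro rfl
      exact hnot hxy
    · refine Or.inr ⟨y, Finset.mem_erase.2 ⟨?_, by simpa⟩, rfl⟩
      rintro rfl
      exact hnot (Sym2.eq_swap ▸ hxy)
  set X : Finset ℕ := A.biUnion f with hX
  have hXcard : X.card ≤ A.card * 2 := by
    refine Finset.card_biUnion_le_card_mul _ _ _ fun e he => ?_
    exact (Finset.mem_powersetCard.1 (h.mem e (Finset.mem_filter.1 he).2)).2.le
  set B : Finset (Sym2 V) := Y.toFinset.biUnion fun y => (G.neighborSet y).toFinset.image (s(y, ·))
    with hB
  have hBcard : B.card ≤ Y.ncard * D := by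
    rw [Set.ncard_eq_toFinset_card' Y]
    refine Finset.card_biUnion_le_card_mul _ _ _ fun y _ => Finset.card_image_le.trans ?_
    rw [← Set.ncard_eq_toFinset_card']
    exact hD y
  obtain ⟨c, hc, hcB⟩ : ∃ c ∈ Finset.powersetCard 2 (Finset.Icc 1 k \ X), c ∉ B.image f := by
    refine Finset.exists_mem_notMem_of_card_lt_card ?_
    refine (Finset.card_image_le.trans hBcard).trans_lt (hcount.trans_le ?_)
    rw [Finset.card_powersetCard]
    refine Nat.choose_le_choose 2 (le_trans ?_ (Finset.le_card_sdiff _ _))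
    rw [Nat.card_Icc]
    omega
  obtain ⟨hcS, hc2⟩ := Finset.mem_powersetCard.1 hc
  have hcA : ∀ e ∈ A, Disjoint c (f e) := by
    intro e he
    rw [Finset.disjoint_left]
    intro i hi hie
    exact (Finset.mem_sdiff.1 (hcS hi)).2 (Finset.mem_biUnion.2 ⟨e, he, hie⟩)
  have hc_nonempty : c.Nonempty := Finset.card_pos.1 (by omega)
  have hcA' : ∀ e ∈ A, f e ≠ c := by
    rintro e he rfl
    exact hc_nonempty.ne_empty (Finset.disjoint_self_iff_empty _ |>.1 (hcA e he))
  have hne : ∀ x y z, x = u ∨ x = v → G.Adj x y → s(y, z) ∈ F → f s(y, z) ≠ c := by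
    intro x y z hx hxy hyz
    by_cases hy : y = u ∨ y = v
    · exact hcA' _ (hmemA y z hy hyz)
    by_cases hz : z = u ∨ z = v
    · rw [Sym2.eq_swap] at hyz ⊢
      exact hcA' _ (hmemA z y hz hyz)
    push Not at hy hz
    rintro rfl
    refine hcB (Finset.mem_image_of_mem f (Finset.mem_biUnion.2 ⟨y, ?_, ?_⟩))
    · simpa using hY x y z hx hxy (hF hyz) hy.1 hy.2 hz.1 hz.2
    · exact Finset.mem_image_of_mem _ (by simpa using hF hyz)
  have hend : ∀ {x y : V}, s(x, y) = s(u, v) → x = u ∨ x = v := by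
    intro x y e
    rcases Sym2.eq_iff.1 e with ⟨rfl, -⟩ | ⟨rfl, -⟩ <;> simp
  have hold : ∀ e ∈ F, Function.update f s(u, v) c e = f e := fun e he =>
    Function.update_of_ne (ne_of_mem_of_not_mem he hnot) _ _
  have hnew : ∀ e, e = s(u, v) → Function.update f s(u, v) c e = c := by
    rintro e rfl
    exact Function.update_self _ _ _
  refine ⟨Function.update f s(u, v) c, ⟨?_, ?_, ?_⟩⟩
  · rintro e (he | he)
    · rw [hnew e he]
      exact Finset.mem_powersetCard.2 ⟨hcS.trans Finset.sdiff_subset, hc2⟩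
    · rw [hold e he]
      exact h.mem e he
  · rintro x y z (hxy | hxy) (hxz | hxz) hyz
    · exact absurd (Sym2.congr_right.1 (hxy.trans hxz.symm)) hyz
    · rw [hnew _ hxy, hold _ hxz]
      exact hcA _ (hmemA x z (hend hxy) hxz)
    · rw [hold _ hxy, hnew _ hxz]
      exact (hcA _ (hmemA x y (hend hxz) hxy)).symm
    · rw [hold _ hxy, hold _ hxz]
      exact h.disj x y z hxy hxz hyz
  · rintro w x y z (hwx | hwx) (hyz | hyz) hadj hdiff
    · exact absurd (hwx.trans hyz.symm) hdiff
    · rw [hnew _ hwx, hold _ hyz]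
      exact (hne x y z (hend (Sym2.eq_swap.trans hwx)) hadj hyz).symm
    · rw [hold _ hwx, hnew _ hyz, Sym2.eq_swap]
      exact hne y x w (hend hyz) hadj.symm (Sym2.eq_swap ▸ hwx)
    · rw [hold _ hwx, hold _ hyz]
      exact h.ne w x y z hwx hyz hadj hdiff

/-- A coloring of a subgraph `H` satisfies the constraints imposed by `G` if edges of `H` that are
joined by an edge of `G` are also joined by an edge of `H`. -/
lemma IsPartialColoring.of_le {H : SimpleGraph V} {k : ℕ} {f : Sym2 V → Finset ℕ}
    (h : H.IsPartialColoring k H.edgeSet f)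
    (hH : ∀ w x y z, H.Adj w x → H.Adj y z → G.Adj x y → ¬ H.Adj x y →
      H.Adj w y ∨ H.Adj x z ∨ H.Adj w z) : G.IsPartialColoring k H.edgeSet f := by
  refine ⟨h.mem, h.disj, fun w x y z hwx hyz hxy hne => ?_⟩
  by_cases hadj : H.Adj x y
  · exact h.ne w x y z hwx hyz hadj hne
  have e1 : s(w, x) = s(x, w) := Sym2.eq_swap
  have e2 : s(y, z) = s(z, y) := Sym2.eq_swap
  rcases hH w x y z hwx hyz hxy hadj with hwy | hxz | hwz
  · rw [e1] at hwx hne ⊢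
    exact h.ne x w y z hwx hyz hwy hne
  · rw [e2] at hyz hne ⊢
    exact h.ne w x z y hwx hyz hxz hne
  · rw [e1] at hwx hne ⊢
    rw [e2] at hyz hne ⊢
    exact h.ne x w z y hwx hyz hwz hne

/-- Deleting a nonempty set of edges gives a smaller graph. -/
lemma deleteEdges_lt {S : Set (Sym2 V)} {u v : V} (huv : G.Adj u v) (hS : s(u, v) ∈ S) :
    G.deleteEdges S < G := by
  refine lt_of_le_of_ne (G.deleteEdges_le S) fun h => ?_
  rw [← h, deleteEdges_adj] at huv
  exact huv.2 hS

/-- By `hH`, edges joined by `uv` are also joined by an edge that survives its deletion, so no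
constraint between old edges is lost. -/
lemma exists_coloring_of_deleteEdge [Finite V] {D k : ℕ}
    (hD : ∀ v, (G.neighborSet v).ncard ≤ D)
    (ih : ∀ H < G, ∃ f, H.IsPartialColoring k H.edgeSet f) {u v : V} (huv : G.Adj u v)
    (hH : ∀ w z, G.Adj w u → w ≠ v → G.Adj v z → z ≠ u →
      (G.Adj w v ∧ w ≠ u) ∨ (G.Adj u z ∧ z ≠ v) ∨ (G.Adj w z ∧ w ≠ u ∧ w ≠ v)) {Y : Set V}
    (hY : ∀ x y z, x = u ∨ x = v → G.Adj x y → G.Adj y z → y ≠ u → y ≠ v → z ≠ u → z ≠ v → y ∈ Y)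
    (hcount : Y.ncard * D <
      (k - 2 * ((G.neighborSet u).ncard + (G.neighborSet v).ncard - 2)).choose 2) :
    ∃ f, G.IsPartialColoring k G.edgeSet f := by
  have hdel {x y : V} : (G.deleteEdges {s(u, v)}).Adj x y ↔
      G.Adj x y ∧ ¬ (x = u ∧ y = v) ∧ ¬ (x = v ∧ y = u) := by
    rw [deleteEdges_adj, Set.mem_singleton_iff, Sym2.eq_iff, not_or]
  obtain ⟨f, hf⟩ := ih _ (deleteEdges_lt huv (Set.mem_singleton s(u, v)))
  have hf' : G.IsPartialColoring k (G.deleteEdges {s(u, v)}).edgeSet f := by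
    refine hf.of_le fun w x y z hwx hyz hxy hnot => ?_
    rw [hdel] at hwx hyz
    have : (x = u ∧ y = v) ∨ (x = v ∧ y = u) := by
      by_contra hcon
      exact hnot (hdel.2 ⟨hxy, not_or.1 hcon⟩)
    rcases this with ⟨rfl, rfl⟩ | ⟨rfl, rfl⟩
    · have h1 := hH w z hwx.1 (fun e => hwx.2.2 ⟨e, rfl⟩) hyz.1 (fun e => hyz.2.2 ⟨rfl, e⟩)
      simp only [hdel]
      have := hwx.1.ne
      have := hyz.1.ne
      grind
    · have h1 := hH z w hyz.1.symm (fun e => hyz.2.1 ⟨rfl, e⟩) hwx.1.symm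
        (fun e => hwx.2.1 ⟨e, rfl⟩)
      simp only [hdel]
      have := hwx.1.ne
      have := hyz.1.ne
      have h2 := G.adj_comm z x
      have h3 := G.adj_comm w y
      have h4 := G.adj_comm w z
      grind
  obtain ⟨f', hf''⟩ := hf'.exists_insert hD (edgeSet_mono (G.deleteEdges_le _)) huv
    (by simp) hY hcount
  refine ⟨f', ?_⟩
  rwa [edgeSet_deleteEdges, Set.insert_sdiff_singleton,
    Set.insert_eq_of_mem ((mem_edgeSet G).2 huv)] at hf''

lemma lt_choose_two {b m n : ℕ} (h : 2 * b < m * (m + 1)) (hmn : m + 1 ≤ n) :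
    b < n.choose 2 := by
  refine lt_of_lt_of_le ?_ (Nat.choose_le_choose 2 hmn)
  rw [Nat.choose_two_right, Nat.add_sub_cancel, Nat.lt_iff_add_one_le,
    Nat.le_div_iff_mul_le two_pos]
  have h2 : Even (m * (m + 1)) := Nat.even_mul_succ_self m
  obtain ⟨r, hr⟩ := h2
  rw [mul_comm (m + 1) m]
  omega

/-- The bound `3 * D` matters here: at least `D + 2` colors remain, and (D+2)(D+1)/2 exceeds 4D for
D ≥ 5, barely so at D = 5 (21 against 20). Smaller `D` is covered by `14 ≤ k`. -/
lemma mul_lt_choose_of_leaf {D k c a : ℕ} (hk : 14 ≤ k) (hkD : 3 * D ≤ k) (hc : c ≤ 4)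
    (ha : a + 1 ≤ D) : c * D < (k - 2 * a).choose 2 := by
  have h1 : c * D ≤ 4 * D := Nat.mul_le_mul_right D hc
  rcases Nat.lt_or_ge D 5 with hD | hD
  · exact lt_choose_two (m := 7) (by omega) (by omega)
  · refine lt_choose_two (m := D + 1) ?_ (by omega)
    nlinarith

lemma mul_lt_choose_of_path {D k c a : ℕ} (hk : 14 ≤ k) (hkD : 3 * D ≤ k) (hc : c ≤ 2)
    (ha : a ≤ 2) : c * D < (k - 2 * a).choose 2 := by
  have h1 : c * D ≤ 2 * D := Nat.mul_le_mul_right D hc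
  obtain ⟨m, rfl⟩ : ∃ m, k = m + 5 := ⟨k - 5, by omega⟩
  refine lt_choose_two (m := m) ?_ (by omega)
  nlinarith

/-- The constant 14 matters here: for D = 4 it leaves six colors, hence 15 pairs against 12
forbidden ones; 13 colors would leave only 10 pairs. -/
lemma mul_lt_choose_of_triangle {D k c a : ℕ} (hk : 14 ≤ k) (hkD : 3 * D ≤ k) (hc : c ≤ 3)
    (ha : a ≤ 4) : c * D < (k - 2 * a).choose 2 := by
  have h1 : c * D ≤ 3 * D := Nat.mul_le_mul_right D hc
  obtain ⟨m, rfl⟩ : ∃ m, k = m + 9 := ⟨k - 9, by omega⟩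
  refine lt_choose_two (m := m) ?_ (by omega)
  rcases Nat.lt_or_ge D 5 with hD | hD
  · nlinarith
  · nlinarith

/-! ### Reducibility of the configurations and the induction -/

/-- A leaf at a vertex with at most four neighbors that are not leaves is reducible. -/
lemma exists_coloring_of_leaf [Finite V] {D k : ℕ} (hk : 14 ≤ k) (hkD : 3 * D ≤ k)
    (hD : ∀ v, (G.neighborSet v).ncard ≤ D)
    (ih : ∀ H < G, ∃ f, H.IsPartialColoring k H.edgeSet f) {u v : V} (huv : G.Adj u v)
    (hu : ∀ z, G.Adj u z → z = v) (hv : {y | G.Adj v y ∧ ∃ z ≠ v, G.Adj y z}.ncard ≤ 4) :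
    ∃ f, G.IsPartialColoring k G.edgeSet f := by
  refine exists_coloring_of_deleteEdge hD ih huv (fun w z hwu hwv _ _ => ?_)
    (Y := {y | G.Adj v y ∧ ∃ z ≠ v, G.Adj y z}) (fun x y z hx hxy hyz _ hyv _ hzv => ?_) ?_
  · exact absurd (hu w hwu.symm) hwv
  · rcases hx with rfl | rfl
    · exact absurd (hu y hxy) hyv
    · exact ⟨hxy, z, hzv, hyz⟩
  · have hNu : G.neighborSet u = {v} := by
      ext z
      exact ⟨fun h => hu z h, fun h => by rw [h]; exact huv⟩
    have h1 : 0 < (G.neighborSet v).ncard := (Set.ncard_pos).2 ⟨u, huv.symm⟩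
    have h2 := hD v
    refine mul_lt_choose_of_leaf hk hkD hv ?_
    rw [hNu, Set.ncard_singleton]
    omega

lemma exists_coloring_of_square [Finite V] {D k : ℕ} (hk : 14 ≤ k) (hkD : 3 * D ≤ k)
    (hD : ∀ v, (G.neighborSet v).ncard ≤ D)
    (ih : ∀ H < G, ∃ f, H.IsPartialColoring k H.edgeSet f) {x u v z : V}
    (hu : G.neighborSet u = {x, v}) (hv : G.neighborSet v = {u, z}) (hxz : G.Adj x z) :
    ∃ f, G.IsPartialColoring k G.edgeSet f := by
  have hNu (y : V) : G.Adj u y ↔ y = x ∨ y = v := by rw [← mem_neighborSet, hu]; rfl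
  have hNv (y : V) : G.Adj v y ↔ y = u ∨ y = z := by rw [← mem_neighborSet, hv]; rfl
  have huv : G.Adj u v := (hNu v).2 (Or.inr rfl)
  have hux : G.Adj u x := (hNu x).2 (Or.inl rfl)
  refine exists_coloring_of_deleteEdge hD ih huv (fun w y hwu hwv hvy hyu => ?_)
    (Y := {x, z}) (fun a y b ha hay _ hyu hyv _ _ => ?_) ?_
  · obtain rfl := ((hNu w).1 hwu.symm).resolve_right hwv
    obtain rfl := ((hNv y).1 hvy).resolve_left hyu
    exact Or.inr (Or.inr ⟨hxz, hux.ne', hwv⟩)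
  · rcases ha with rfl | rfl
    · exact Or.inl (((hNu y).1 hay).resolve_right hyv)
    · exact Or.inr (((hNv y).1 hay).resolve_left hyu)
  · refine mul_lt_choose_of_path hk hkD (ncard_pair_le_two _ _) ?_
    have h1 := ncard_pair_le_two x v
    have h2 := ncard_pair_le_two u z
    rw [hu, hv]
    omega

lemma exists_coloring_of_triangle [Finite V] {D k : ℕ} (hk : 14 ≤ k) (hkD : 3 * D ≤ k)
    (hD : ∀ v, (G.neighborSet v).ncard ≤ D)
    (ih : ∀ H < G, ∃ f, H.IsPartialColoring k H.edgeSet f) {u v w : V}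
    (hu : G.neighborSet u = {v, w}) (hvw : G.Adj v w) (hv : (G.neighborSet v).ncard ≤ 4) :
    ∃ f, G.IsPartialColoring k G.edgeSet f := by
  have hNu (y : V) : G.Adj u y ↔ y = v ∨ y = w := by rw [← mem_neighborSet, hu]; rfl
  have huv : G.Adj u v := (hNu v).2 (Or.inl rfl)
  have huw : G.Adj u w := (hNu w).2 (Or.inr rfl)
  refine exists_coloring_of_deleteEdge hD ih huv (fun a y hau hav _ _ => ?_)
    (Y := G.neighborSet v \ {u}) (fun a y b ha hay _ hyu hyv _ _ => ?_) ?_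
  · obtain rfl := ((hNu a).1 hau.symm).resolve_left hav
    exact Or.inl ⟨hvw.symm, hau.ne⟩
  · rcases ha with rfl | rfl
    · obtain rfl := ((hNu y).1 hay).resolve_left hyv
      exact ⟨hvw, hyu⟩
    · exact ⟨hay, hyu⟩
  · have h1 := ncard_pair_le_two v w
    have h2 := Set.ncard_sdiff_singleton_of_mem (show u ∈ G.neighborSet v from huv.symm)
    refine mul_lt_choose_of_triangle hk hkD (by omega) ?_
    rw [hu]
    omega

lemma exists_coloring_of_path [Finite V] {D k : ℕ} (hk : 14 ≤ k) (hkD : 3 * D ≤ k)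
    (hD : ∀ v, (G.neighborSet v).ncard ≤ D)
    (ih : ∀ H < G, ∃ f, H.IsPartialColoring k H.edgeSet f) {x u v w z : V}
    (huw : u ≠ w) (hu : G.neighborSet u = {x, v}) (hv : G.neighborSet v = {u, w})
    (hw : G.neighborSet w = {v, z}) : ∃ f, G.IsPartialColoring k G.edgeSet f := by
  have hNu (y : V) : G.Adj u y ↔ y = x ∨ y = v := by rw [← mem_neighborSet, hu]; rfl
  have hNv (y : V) : G.Adj v y ↔ y = u ∨ y = w := by rw [← mem_neighborSet, hv]; rfl
  have hNw (y : V) : G.Adj w y ↔ y = v ∨ y = z := by rw [← mem_neighborSet, hw]; rfl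
  have hvu : G.Adj v u := (hNv u).2 (Or.inl rfl)
  have hvw : G.Adj v w := (hNv w).2 (Or.inr rfl)
  have h1 := ncard_pair_le_two x v
  have h2 := ncard_pair_le_two u w
  have h3 := ncard_pair_le_two v z
  -- Deleting one edge could lose the constraint between the edges next to it. With both edges at
  -- `v` deleted, `v` is isolated and nothing is lost; the two edges are then colored one after the
  -- other.
  set S : Set (Sym2 V) := {s(v, u), s(v, w)} with hS
  have hiso (y : V) : ¬ (G.deleteEdges S).Adj v y := by
    rw [deleteEdges_adj, hNv]
    rintro ⟨rfl | rfl, h⟩ <;> exact h (by simp [hS])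
  obtain ⟨f, hf⟩ := ih _ (deleteEdges_lt hvu (S := S) (by simp [hS]))
  have hf' : G.IsPartialColoring k (G.deleteEdges S).edgeSet f := by
    refine hf.of_le fun a b c d hab hcd hbc hnot => ?_
    rw [deleteEdges_adj] at hnot
    have hmem : s(b, c) ∈ S := by
      by_contra h
      exact hnot ⟨hbc, h⟩
    have : b = v ∨ c = v := by
      rcases hmem with h | h <;> rcases Sym2.eq_iff.1 h with ⟨h, -⟩ | ⟨-, h⟩ <;> simp [h]
    rcases this with rfl | rfl
    · exact absurd hab.symm (hiso a)
    · exact absurd hcd (hiso d)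
  have hle : (G.deleteEdges S).edgeSet ⊆ G.edgeSet := edgeSet_mono (G.deleteEdges_le _)
  obtain ⟨f₁, hf₁⟩ := hf'.exists_insert hD hle hvu (by simp [hS]) (Y := {x, w})
    (fun a y b ha hay _ hyv hyu _ _ => by
      rcases ha with rfl | rfl
      · exact Or.inr (((hNv y).1 hay).resolve_left hyu)
      · exact Or.inl (((hNu y).1 hay).resolve_right hyv))
    (mul_lt_choose_of_path hk hkD (ncard_pair_le_two _ _) (by rw [hu, hv]; omega))
  obtain ⟨f₂, hf₂⟩ := hf₁.exists_insert hD (Set.insert_subset hvu hle) hvw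
    (by simp [hS, huw.symm, hvw.ne']) (Y := {u, z})
    (fun a y b ha hay _ hyv hyw _ _ => by
      rcases ha with rfl | rfl
      · exact Or.inl (((hNv y).1 hay).resolve_right hyw)
      · exact Or.inr (((hNw y).1 hay).resolve_left hyv))
    (mul_lt_choose_of_path hk hkD (ncard_pair_le_two _ _) (by rw [hv, hw]; omega))
  refine ⟨f₂, ?_⟩
  convert hf₂ using 1
  rw [edgeSet_deleteEdges, hS]
  ext e
  by_cases e1 : e = s(v, u) <;> by_cases e2 : e = s(v, w)
  all_goals simp [e1, e2, hvu, hvw]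

/-- If no leaf is adjacent to a vertex with at most four neighbors that are not leaves, then
a graph has a reducible configuration because this holds after deletion of all leaves. -/
lemma hasReducibleConfiguration_of_leaves [Finite V] (h4 : ¬ G.HasK4Minor)
    (h23 : ¬ G.HasK23Minor)
    (hleaf : ∀ u v, G.Adj u v → (∀ z, G.Adj u z → z = v) →
      4 < {y | G.Adj v y ∧ ∃ z ≠ v, G.Adj y z}.ncard) {a b : V} (hab : G.Adj a b) :
    G.HasReducibleConfiguration := by
  let H : SimpleGraph V :=
    { Adj := fun x y => G.Adj x y ∧ (∃ z ≠ y, G.Adj x z) ∧ ∃ z ≠ x, G.Adj y z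
      symm := ⟨fun x y h => ⟨h.1.symm, h.2.2, h.2.1⟩⟩
      loopless := ⟨fun x h => G.loopless.irrefl x h.1⟩ }
  have hle : H ≤ G := fun _ _ h => h.1
  have hN (x : V) (hx : ∃ y, H.Adj x y) :
      H.neighborSet x = {y | G.Adj x y ∧ ∃ z ≠ x, G.Adj y z} := by
    obtain ⟨y, hxy, ⟨z, hzy, hxz⟩, -⟩ := hx
    ext w
    refine ⟨fun h => ⟨h.1, h.2.2⟩, fun h => ⟨h.1, ?_, h.2⟩⟩
    by_cases hw : w = y
    · exact ⟨z, hw ▸ hzy, hxz⟩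
    · exact ⟨y, Ne.symm hw, hxy⟩
  -- By `hleaf`, a neighbor of a leaf keeps more than four neighbors in `H`. So a vertex of positive
  -- degree at most four in `H` has lost no neighbor.
  have hsame (x : V) (hx : ∃ y, H.Adj x y) (hcard : (H.neighborSet x).ncard ≤ 4) :
      G.neighborSet x = H.neighborSet x := by
    rw [hN x hx] at hcard ⊢
    ext w
    refine ⟨fun h => ⟨h, ?_⟩, fun h => h.1⟩
    by_contra hcon
    push Not at hcon
    have := hleaf w x (show G.Adj x w from h).symm
      fun z hz => by_contra fun hne => hcon z hne hz
    omega
  have hdeg : ∀ x y, H.Adj x y → ∃ z ≠ y, H.Adj x z := by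
    intro x y hxy
    by_cases hcard : (H.neighborSet x).ncard ≤ 4
    · obtain ⟨z, hzy, hxz⟩ := hxy.2.1
      have : z ∈ H.neighborSet x := hsame x ⟨y, hxy⟩ hcard ▸ hxz
      exact ⟨z, hzy, this⟩
    · obtain ⟨z, hz, hzy⟩ := Set.exists_ne_of_one_lt_ncard (s := H.neighborSet x) (by omega) y
      exact ⟨z, hzy, hz⟩
  have hedge : ∃ x y, H.Adj x y := by
    have key {u v : V} (huv : G.Adj u v) (hu : ∀ z, G.Adj u z → z = v) : ∃ x y, H.Adj x y := by
      have hc := hleaf u v huv hu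
      obtain ⟨y, hy, z, hz, hyz⟩ := Set.one_lt_ncard_iff_nontrivial.1
        (lt_trans (by norm_num) hc)
      exact ⟨v, y, hy.1, ⟨z, hyz.symm, hz.1⟩, hy.2⟩
    by_cases h1 : ∀ z, G.Adj a z → z = b
    · exact key hab h1
    by_cases h2 : ∀ z, G.Adj b z → z = a
    · exact key hab.symm h2
    push Not at h1 h2
    obtain ⟨z, h1, h1'⟩ := h1
    obtain ⟨z', h2, h2'⟩ := h2
    exact ⟨a, b, hab, ⟨z, h1', h1⟩, z', h2', h2⟩
  obtain ⟨x, y, hxy⟩ := hedge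
  have hpair {u v w : V} (h : H.neighborSet u = {v, w}) : G.neighborSet u = {v, w} := by
    rw [hsame u ⟨v, by rw [← mem_neighborSet, h]; simp⟩
      (by rw [h]; exact (ncard_pair_le_two v w).trans (by norm_num)), h]
  rcases hasReducibleConfiguration (fun h => h4 (h.mono hle)) (fun h => h23 (h.mono hle)) hdeg hxy
    with ⟨x, u, v, w, z, huw, hu, hv, hw⟩ | ⟨x, u, v, z, hu, hv, hxz⟩ | ⟨u, v, w, hu, hvw, hv⟩
  · exact Or.inl ⟨x, u, v, w, z, huw, hpair hu, hpair hv, hpair hw⟩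
  · exact Or.inr (Or.inl ⟨x, u, v, z, hpair hu, hpair hv, hle hxz⟩)
  · refine Or.inr (Or.inr ⟨u, v, w, hpair hu, hle hvw, ?_⟩)
    rw [hsame v ⟨w, hvw⟩ hv]
    exact hv

/-- The induction runs over proper subgraphs with `D` and `k` fixed; the excluded minors and the
degree bound pass to subgraphs. -/
theorem exists_coloring [Finite V] {D k : ℕ} (hk : 14 ≤ k) (hkD : 3 * D ≤ k)
    (h4 : ¬ G.HasK4Minor) (h23 : ¬ G.HasK23Minor) (hD : ∀ v, (G.neighborSet v).ncard ≤ D) :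
    ∃ f, G.IsPartialColoring k G.edgeSet f := by
  induction G using WellFoundedLT.induction with
  | ind G ih =>
  replace ih : ∀ H < G, ∃ f, H.IsPartialColoring k H.edgeSet f := fun H hH =>
    ih H hH (fun h => h4 (h.mono hH.le)) (fun h => h23 (h.mono hH.le)) fun v =>
      (Set.ncard_le_ncard fun _ h => hH.le h).trans (hD v)
  by_cases hleaf : ∃ u v, G.Adj u v ∧ (∀ z, G.Adj u z → z = v) ∧
      {y | G.Adj v y ∧ ∃ z ≠ v, G.Adj y z}.ncard ≤ 4
  · obtain ⟨u, v, huv, hu, hv⟩ := hleaf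
    exact exists_coloring_of_leaf hk hkD hD ih huv hu hv
  push Not at hleaf
  by_cases hE : ∃ a b, G.Adj a b
  · obtain ⟨a, b, hab⟩ := hE
    rcases hasReducibleConfiguration_of_leaves h4 h23 hleaf hab with
      ⟨x, u, v, w, z, huw, hu, hv, hw⟩ | ⟨x, u, v, z, hu, hv, hxz⟩ | ⟨u, v, w, hu, hvw, hv⟩
    · exact exists_coloring_of_path hk hkD hD ih huw hu hv hw
    · exact exists_coloring_of_square hk hkD hD ih hu hv hxz
    · exact exists_coloring_of_triangle hk hkD hD ih hu hvw hv
  · push Not at hE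
    refine ⟨fun _ => ∅, ⟨fun e => ?_, fun x y _ h => absurd h (hE x y),
      fun w x _ _ h => absurd h (hE w x)⟩⟩
    induction e with
    | h x y => exact fun h => absurd h (hE x y)

/-- A violation gives a walk in the line graph no longer than the number of shared colors, hence of
length at most two. Length one means a common end; length two means a middle edge joining the two
edges or again a common end. -/
lemma IsPartialColoring.isToneEdgeColoring {k : ℕ} {f : Sym2 V → Finset ℕ}
    (h : G.IsPartialColoring k G.edgeSet f) : G.IsToneEdgeColoring 2 k fun e => f e := by
  refine ⟨fun e => h.mem e e.2, fun e e' hne => ?_⟩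
  have hne' : (e : Sym2 V) ≠ e' := fun h => hne (Subtype.ext h)
  have hcard (e : G.edgeSet) : (f e).card = 2 := (Finset.mem_powersetCard.1 (h.mem e e.2)).2
  have hshare {v : V} (hv : v ∈ (e : Sym2 V)) (hv' : v ∈ (e' : Sym2 V)) :
      (f e ∩ f e').card = 0 := by
    obtain ⟨y, hy⟩ := hv
    obtain ⟨z, hz⟩ := hv'
    rw [Finset.card_eq_zero, ← Finset.disjoint_iff_inter_eq_empty, hy, hz]
    exact h.disj v y z (hy ▸ e.2) (hz ▸ e'.2) fun e => hne' (by rw [hy, hz, e])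
  by_contra! hcon
  obtain ⟨p, hp⟩ := exists_walk_of_edist_ne_top
    (ne_top_of_le_ne_top (ENat.natCast_ne_top _) hcon)
  rw [← hp, Nat.cast_le] at hcon
  have hle : (f e ∩ f e').card ≤ 2 := (Finset.card_le_card Finset.inter_subset_left).trans
    (hcard e).le
  rcases p with _ | ⟨h1, _ | ⟨h2, _ | ⟨h3, p⟩⟩⟩ <;>
    simp only [Walk.length_cons, Walk.length_nil] at hcon
  · exact hne rfl
  · obtain ⟨-, v, hv, hv'⟩ := h1
    rw [hshare hv hv'] at hcon
    omega
  · rename_i g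
    obtain ⟨-, x, hx, hxg⟩ := h1
    obtain ⟨-, y, hyg, hy⟩ := h2
    by_cases hxy : x = y
    · subst hxy
      rw [hshare hx hy] at hcon
      omega
    have hgxy : (g : Sym2 V) = s(x, y) := ((Sym2.mem_and_mem_iff hxy).1 ⟨hxg, hyg⟩)
    have hadj : G.Adj x y := by
      rw [← mem_edgeSet, ← hgxy]; exact g.2
    have heq : f e = f e' := by
      have h1 : f e ∩ f e' = f e :=
        Finset.eq_of_subset_of_card_le Finset.inter_subset_left (by rw [hcard]; omega)
      have h2 : f e ∩ f e' = f e' :=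
        Finset.eq_of_subset_of_card_le Finset.inter_subset_right (by rw [hcard]; omega)
      exact h1.symm.trans h2
    obtain ⟨w, hw⟩ := hx
    obtain ⟨z, hz⟩ := hy
    rw [Sym2.eq_swap] at hw
    rw [hw, hz] at heq hne'
    exact h.ne w x y z (hw ▸ e.2) (hz ▸ e'.2) hadj hne' heq
  · omega

end SimpleGraph

theorem theorem4 {V : Type*} [Fintype V] (G : SimpleGraph V) [DecidableRel G.Adj]
    (hG : G.IsOuterplanar) :
    G.toneChromaticIndex 2 ≤ ((max 14 (3 * G.maxDegree) : ℕ) : ℕ∞) := by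
  have hD (v : V) : (G.neighborSet v).ncard ≤ G.maxDegree := by
    rw [Set.ncard_eq_toFinset_card']
    exact G.degree_le_maxDegree v
  obtain ⟨f, hf⟩ := SimpleGraph.exists_coloring (le_max_left 14 _) (le_max_right 14 _)
    hG.not_hasK4Minor hG.not_hasK23Minor hD
  exact iInf₂_le _ ⟨_, hf.isToneEdgeColoring⟩
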